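/- Let $2\le k\le n$ and let $\Omega\subset\mathbb R^n$ be a bounded $C^3$ strictly convex domain (a nonempty bounded open convex set with $C^3$ boundary, all of whose principal curvatures are positive), with outer unit normal $\nu$ on $\partial\Omega$. For a real symmetric matrix $S$ let $\sigma_m(S)$ be the $m$-th elementary symmetric function of its eigenvalues ($\sigma_0=1$); a $C^2$ function $u$ is called $k$-admissible if $\sigma_i(D^2u(x))>0$ for all $x\in\Omega$ and $1\le i\le k$. For every $a>0$ and $A,B\ge 0$ there are constants $\varepsilon_0>0$, $M_1$ and $\overline{M_0}$, depending only on $n$, $k$, $\Omega$, $a$, $A$ and $B$, with the following property. Let $\alpha_0,\dots,\alpha_{k-1}\in C^1(\overline\Omega)$ with $\inf_{\Omega}\alpha_l\ge a$ and $|\alpha_l|_{C^1(\overline\Omega)}\le A$ for all $l$, let $\varphi\in C^2(\partial\Omega)$ with $|\varphi|_{C^2(\partial\Omega)}\le B$ (the norm being the infimum of the $C^2(\overline\Omega)$ norms of the $C^2(\overline\Omega)$ extensions of $\varphi$), let $0<\varepsilon<\varepsilon_0$, and let $u\in C^3(\Omega)\cap C^2(\overline\Omega)$ be a $k$-admissible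 solution of $$\sigma_k(D^2u)=\sum_{l=0}^{k-1}\alpha_l(x)\,\sigma_l(D^2u)\ \text{ in }\Omega,\qquad u_\nu=-\varepsilon u+\varphi(x)\ \text{ on }\partial\Omega .$$ Then $$\sup_\Omega|Du|\le M_1\qquad\text{and}\qquad \sup_\Omega\Big|u-\frac1{|\Omega|}\int_\Omega u\Big|\le\overline{M_0}.$$ In particular the constants do not depend on $\varepsilon$. -/

import Mathlib

open scoped ENNReal NNReal Topology RealInnerProductSpace
open MeasureTheory

noncomputable section

namespace MixedHessian

/-- The Euclidean space `ℝⁿ`. -/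
abbrev E (n : ℕ) := EuclideanSpace ℝ (Fin n)

/-! ### Domains with smooth boundary -/

/-- `ρ` is a `C^m` defining function of `Ω` near the boundary point `p`:
near `p` the set `Ω` is `{ρ < 0}`, and `Dρ(p) ≠ 0`. -/
structure IsLocalDefiningFunction {n : ℕ} (m : ℕ) (Ω : Set (E n)) (p : E n) (ρ : E n → ℝ) :
    Prop where
  contDiffAt : ContDiffAt ℝ (m : WithTop ℕ∞) ρ p
  apply_eq_zero : ρ p = 0
  gradient_ne_zero : gradient ρ p ≠ 0
  mem_iff : ∀ᶠ x in 𝓝 p, (x ∈ Ω ↔ ρ x < 0)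

/-- A bounded `C^m` strictly convex domain (to be used with `m ≥ 2`): a nonempty bounded open
convex set whose boundary is locally the regular zero set of a `C^m` defining function `ρ`, all
principal curvatures of the boundary being positive.  The second fundamental form at `p` with
respect to the inner normal is `D²ρ(p) / |Dρ(p)|` restricted to the tangent space
`{τ : Dρ(p) τ = 0}`. -/
structure IsStrictlyConvexDomain {n : ℕ} (m : ℕ) (Ω : Set (E n)) : Prop where
  isOpen : IsOpen Ω
  nonempty : Ω.Nonempty
  isBounded : Bornology.IsBounded Ω
  convex : Convex ℝ Ω
  boundary : ∀ p ∈ frontier Ω, ∃ ρ : E n → ℝ, IsLocalDefiningFunction m Ω p ρ ∧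
    ∀ τ : E n, τ ≠ 0 → fderiv ℝ ρ p τ = 0 → 0 < fderiv ℝ (fderiv ℝ ρ) p τ τ

/-- `ν` is the outer unit normal of `∂Ω` at `p`, that is `ν = Dρ(p) / |Dρ(p)|` for a `C¹` local
defining function `ρ`. -/
def IsOuterUnitNormal {n : ℕ} (Ω : Set (E n)) (p ν : E n) : Prop :=
  ∃ ρ : E n → ℝ, IsLocalDefiningFunction 1 Ω p ρ ∧ ν = ‖gradient ρ p‖⁻¹ • gradient ρ p

/-! ### `C^m` norms -/

/-- The norm `|f|_{C^m(Ω̄)} = ∑_{j ≤ m} sup_Ω |D^j f|`, with values in `[0, ∞]`. -/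
def cNorm {n : ℕ} (m : ℕ) (Ω : Set (E n)) (f : E n → ℝ) : ℝ≥0∞ :=
  ∑ j ∈ Finset.range (m + 1), ⨆ x ∈ Ω, ‖iteratedFDeriv ℝ j f x‖ₑ

/-- `Φ` is a `C^m(Ω̄)` extension of the function `φ` on `∂Ω`. -/
def IsExtension {n : ℕ} (m : ℕ) (Ω : Set (E n)) (φ Φ : E n → ℝ) : Prop :=
  ContDiffOn ℝ (m : WithTop ℕ∞) Φ (closure Ω) ∧ Set.EqOn Φ φ (frontier Ω)

/-- `φ ∈ C^m(∂Ω)`: the restriction of `φ` to `∂Ω` is the boundary value of a `C^m(Ω̄)` function.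
Only the values of `φ` on `∂Ω` matter. -/
def MemCBoundary {n : ℕ} (m : ℕ) (Ω : Set (E n)) (φ : E n → ℝ) : Prop :=
  ∃ Φ : E n → ℝ, IsExtension m Ω φ Φ

/-- The norm `|φ|_{C^m(∂Ω)}`: the infimum of `|Φ|_{C^m(Ω̄)}` over all `C^m(Ω̄)` extensions `Φ`. -/
def cBoundaryNorm {n : ℕ} (m : ℕ) (Ω : Set (E n)) (φ : E n → ℝ) : ℝ≥0∞ :=
  ⨅ (Φ : E n → ℝ) (_ : IsExtension m Ω φ Φ), cNorm m Ω Φ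

/-! ### Mixed Hessian equations -/

/-- The Hessian matrix `D²u(x)`. -/
def hessian {n : ℕ} (u : E n → ℝ) (x : E n) : Matrix (Fin n) (Fin n) ℝ :=
  Matrix.of fun i j =>
    fderiv ℝ (fderiv ℝ u) x (EuclideanSpace.single i 1) (EuclideanSpace.single j 1)

/-- The eigenvalues of a real matrix with multiplicity (all of them when it is symmetric). -/
def eigenvalues {n : ℕ} (A : Matrix (Fin n) (Fin n) ℝ) : Multiset ℝ :=
  A.charpoly.roots

/-- `σ_m(A)`, the `m`-th elementary symmetric function of the eigenvalues; `σ_0 = 1`. -/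
def sigma {n : ℕ} (m : ℕ) (A : Matrix (Fin n) (Fin n) ℝ) : ℝ :=
  (eigenvalues A).esymm m

/-- Gårding's cone `Γ_k`, for unordered tuples of real numbers. -/
def gardingCone (k : ℕ) : Set (Multiset ℝ) :=
  {s | ∀ i : ℕ, 1 ≤ i → i ≤ k → 0 < s.esymm i}

/-- `u` is `k`-admissible in `Ω`. -/
def IsAdmissible {n : ℕ} (k : ℕ) (Ω : Set (E n)) (u : E n → ℝ) : Prop :=
  ∀ x ∈ Ω, eigenvalues (hessian u x) ∈ gardingCone k

/-- `u ∈ C³(Ω) ∩ C²(Ω̄)` is a `k`-admissible solution of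
`σ_k(D²u) = ∑_{l<k} α_l σ_l(D²u)` in `Ω`, `u_ν = -ε u + φ` on `∂Ω`.
At boundary points the differential of `u` is the one relative to `Ω̄`. -/
structure IsApproxSolution {n : ℕ} (k : ℕ) (Ω : Set (E n)) (α : Fin k → E n → ℝ) (φ : E n → ℝ)
    (ε : ℝ) (u : E n → ℝ) : Prop where
  contDiffOn : ContDiffOn ℝ 3 u Ω
  contDiffOn_closure : ContDiffOn ℝ 2 u (closure Ω)
  admissible : IsAdmissible k Ω u
  equation : ∀ x ∈ Ω, sigma k (hessian u x) = ∑ l : Fin k, α l x * sigma (l : ℕ) (hessian u x)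
  neumann : ∀ p ∈ frontier Ω, ∀ ν : E n, IsOuterUnitNormal Ω p ν →
    fderivWithin ℝ u (closure Ω) p ν = -ε * u p + φ p

end MixedHessian

end

noncomputable section

namespace MixedHessian

/-! ### Elementary symmetric functions -/

/-! The proof is a maximum principle for G = |Du - bN|² + (K/2)|x|², where b = Φ - εu, Φ is a C²
extension of φ and N a global C² extension of the outer normal. By the Neumann condition, W = Du -
bN is tangential on ∂Ω.

Interior. At a point, diagonalize D²u and let F^i be the diagonal coefficients of the linearization
of σ_k - ∑ α_l σ_l. On admissible solutions F^i ≥ 0, and the trace T = ∑ F^i controls every σ_l with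
l < k (`sum_esym_le`); this rests on Newton's inequality and on α_l ≥ a > 0. After division by T
both the linearized operator applied to u and the differentiated equation are bounded by structural
constants (`exists_linearized`). At an interior maximum of G, the averaged second derivative test
therefore bounds K by an expression in M = max |Du| whose only quadratic term is of size εM²
(`le_of_isLocalMax`). A larger K forces the maximum onto ∂Ω.

Boundary. At a maximum p ∈ ∂Ω the normal derivative of G is nonnegative. It contains D²u(ν, W),
which is found by differentiating u_ν = b along the tangent vector W. Strict convexity contributes
-κ|W|², so that 2κ|W|² ≤ C|W| + KR (`boundary_estimate`), with no condition on the sign of b. Hence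
M² ≤ P₀ + P₁K, where P₀ and P₁ depend neither on u nor on ε; since K is linear in M up to the εM²
term, a small ε lets that term be absorbed and M is bounded.

The coefficient b must be bounded independently of ε, which requires a bound on εu only, not on u.
It comes from the maximum principle for u and for u - (β/2)|x|² with β large (`eps_mul_le`,
`neg_le_eps_mul`). The oscillation bound is then the mean value inequality on the convex set Ω. -/

theorem esymm_cons (a : ℝ) (s : Multiset ℝ) (m : ℕ) :
    (a ::ₘ s).esymm (m + 1) = s.esymm (m + 1) + a * s.esymm m := by
  simp only [Multiset.esymm, Multiset.powersetCard_cons, Multiset.map_add, Multiset.sum_add,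
    Multiset.map_map, Function.comp_def, Multiset.prod_cons, Multiset.sum_map_mul_left]

theorem esymm_zero' (s : Multiset ℝ) : s.esymm 0 = 1 := by
  simp [Multiset.esymm]

theorem esymm_eq_zero {s : Multiset ℝ} {m : ℕ} (h : Multiset.card s < m) : s.esymm m = 0 := by
  simp [Multiset.esymm, Multiset.powersetCard_eq_empty _ h]

/-- Newton's inequality for the three top indices, by induction on the number of entries. After
splitting off an entry a, (m+2) times the new gap equals (m+3)a² times the old gap plus the square
of (m+2)q0 - a q1. -/
theorem newton_top (m : ℕ) : ∀ s : Multiset ℝ, Multiset.card s = m + 2 →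
    2 * (m + 2) * (s.esymm m * s.esymm (m + 2)) ≤ (m + 1) * s.esymm (m + 1) ^ 2 := by
  induction m with
  | zero =>
    intro s hs
    obtain ⟨x, y, rfl⟩ := Multiset.card_eq_two.1 hs
    have h1 : Multiset.esymm {x, y} 1 = x + y := by
      have : ({x, y} : Multiset ℝ) = x ::ₘ y ::ₘ 0 := rfl
      rw [this, esymm_cons, esymm_cons, esymm_eq_zero (by simp), esymm_zero', esymm_zero']
      ring
    have h2 : Multiset.esymm {x, y} 2 = x * y := by
      have : ({x, y} : Multiset ℝ) = x ::ₘ y ::ₘ 0 := rfl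
      rw [this, esymm_cons, esymm_eq_zero (by simp), esymm_cons, esymm_eq_zero (by simp),
        esymm_zero']
      ring
    simp only [zero_add, h1, h2, esymm_zero']
    push_cast
    nlinarith [sq_nonneg (x - y)]
  | succ m ih =>
    intro s hs
    obtain ⟨a, t, rfl, ht⟩ := Multiset.card_eq_succ_iff.1 hs
    have := ih t (by omega)
    rw [esymm_cons a t (m + 2), esymm_cons a t (m + 1), esymm_cons a t m,
      esymm_eq_zero (s := t) (m := m + 2 + 1) (by omega)]
    set q0 := t.esymm (m + 2)
    set q1 := t.esymm (m + 1)
    set q2 := t.esymm m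
    push_cast
    have hm : (0 : ℝ) ≤ m := Nat.cast_nonneg m
    have key : 0 ≤ ((m : ℝ) + 2) * (((m : ℝ) + 1 + 1) * (q0 + a * q1) ^ 2
        - 2 * ((m : ℝ) + 1 + 2) * ((q1 + a * q2) * (0 + a * q0))) := by
      have h3 : 0 ≤ (((m : ℝ) + 2) * q0 - a * q1) ^ 2 := sq_nonneg _
      have h4 := mul_le_mul_of_nonneg_left this
        (show 0 ≤ ((m : ℝ) + 3) * a ^ 2 by positivity)
      nlinarith
    have := nonneg_of_mul_nonneg_right key (by positivity)
    linarith

/-- By Rolle, the derivative of ∏(X + r) again has only real roots, and its coefficients are those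
of the product up to explicit factors. This reduces Newton's inequality to the top indices. -/
theorem exists_esymm_derivative {n : ℕ} {s : Multiset ℝ} (hs : Multiset.card s = n + 1) :
    ∃ t : Multiset ℝ, Multiset.card t = n ∧
      ∀ j ≤ n, (n + 1 : ℝ) * t.esymm j = (n + 1 - j) * s.esymm j := by
  set p : Polynomial ℝ := (s.map fun r => Polynomial.X + Polynomial.C r).prod with hp
  have hpm : p.Monic := Polynomial.monic_multiset_prod_of_monic _ _ fun r _ =>
    Polynomial.monic_X_add_C r
  have hp' : p = ((s.map fun r => -r).map fun r => Polynomial.X - Polynomial.C r).prod := by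
    rw [hp, Multiset.map_map]; simp
  have hpd : p.natDegree = n + 1 := by
    rw [hp', Polynomial.natDegree_multiset_prod_X_sub_C_eq_card, Multiset.card_map, hs]
  have hps : p.roots = s.map fun r => -r := by
    rw [hp', Polynomial.roots_multiset_prod_X_sub_C]
  have hdd : (Polynomial.derivative p).natDegree = n := by
    rw [Polynomial.natDegree_derivative, hpd]; simp
  have hcard : Multiset.card (Polynomial.derivative p).roots
      = (Polynomial.derivative p).natDegree := by
    apply le_antisymm (Polynomial.card_roots' _)
    have := p.card_roots_le_derivative
    rw [hps, Multiset.card_map, hs] at this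
    omega
  have hlc : (Polynomial.derivative p).leadingCoeff = n + 1 := by
    rw [Polynomial.leadingCoeff, hdd, Polynomial.coeff_derivative, ← hpd,
      Polynomial.coeff_natDegree, hpm.leadingCoeff, one_mul]
  refine ⟨(Polynomial.derivative p).roots.map fun r => -r, by rw [Multiset.card_map, hcard, hdd],
    fun j hj => ?_⟩
  have h1 := Polynomial.coeff_eq_esymm_roots_of_card hcard (k := n - j) (by omega)
  rw [hlc, hdd, Nat.sub_sub_self hj, Polynomial.coeff_derivative, hp,
    Multiset.prod_X_add_C_coeff _ (by omega), hs, show n + 1 - (n - j + 1) = j by omega,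
    mul_assoc, ← Multiset.esymm_neg] at h1
  rw [← h1]
  push_cast [Nat.cast_sub hj]
  ring

/-- Newton's inequality. -/
theorem newton_sharp (m d : ℕ) : ∀ s : Multiset ℝ, Multiset.card s = m + 2 + d →
    (m + 2) * (d + 2) * (s.esymm m * s.esymm (m + 2)) ≤
      (m + 1) * (d + 1) * s.esymm (m + 1) ^ 2 := by
  induction d with
  | zero =>
    intro s hs
    have := newton_top m s (by omega)
    push_cast
    linarith
  | succ d ih =>
    intro s hs
    obtain ⟨t, ht, htj⟩ := exists_esymm_derivative (n := m + 2 + d) hs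
    have h := ih t ht
    have h0 := htj m (by omega)
    have h1 := htj (m + 1) (by omega)
    have h2 := htj (m + 2) (by omega)
    set N : ℝ := ((m + 2 + d : ℕ) : ℝ) + 1 with hN
    have hNp : 0 < N := by positivity
    have hm : (0 : ℝ) ≤ m := Nat.cast_nonneg m
    have hd : (0 : ℝ) ≤ d := Nat.cast_nonneg d
    have e0 : N * t.esymm m = (d + 3) * s.esymm m := by
      rw [h0, hN]; push_cast; ring
    have e1 : N * t.esymm (m + 1) = (d + 2) * s.esymm (m + 1) := by
      rw [h1, hN]; push_cast; ring
    have e2 : N * t.esymm (m + 2) = (d + 1) * s.esymm (m + 2) := by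
      rw [h2, hN]; push_cast; ring
    have h' := mul_le_mul_of_nonneg_left h (sq_nonneg N)
    have e3 : N ^ 2 * ((m + 2) * (d + 2) * (t.esymm m * t.esymm (m + 2)))
        = (m + 2) * (d + 2) * (((d + 3) * s.esymm m) * ((d + 1) * s.esymm (m + 2))) := by
      rw [← e0, ← e2]; ring
    have e4 : N ^ 2 * ((m + 1) * (d + 1) * t.esymm (m + 1) ^ 2)
        = (m + 1) * (d + 1) * ((d + 2) * s.esymm (m + 1)) ^ 2 := by
      rw [← e1]; ring
    rw [e3, e4] at h'
    -- Rescaled to `s`, the inequality for the derivative is the claim times this common factor.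
    have hpos : (0 : ℝ) < (d + 1) * (d + 2) := by positivity
    push_cast
    refine le_of_mul_le_mul_left ?_ hpos
    linarith

theorem newton_weak (s : Multiset ℝ) (m : ℕ) :
    s.esymm m * s.esymm (m + 2) ≤ s.esymm (m + 1) ^ 2 := by
  rcases lt_or_ge (Multiset.card s) (m + 2) with h | h
  · rw [esymm_eq_zero h, mul_zero]; positivity
  · obtain ⟨d, hd⟩ := Nat.exists_eq_add_of_le h
    have := newton_sharp m d s hd
    have hpos : (0 : ℝ) < (m + 2) * (d + 2) := by positivity
    refine le_of_mul_le_mul_left (this.trans ?_) hpos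
    gcongr <;> norm_num

/-- Induction on m. With x, y, z the functions of orders m, m+1, m+2 of `s`, one has x(z + ay) - y(y
+ ax) = xz - y². If y ≤ 0 the left side is positive, which contradicts Newton's inequality. -/
theorem esymm_pos_of_cons {a : ℝ} {s : Multiset ℝ} {k : ℕ} (h : a ::ₘ s ∈ gardingCone (k + 1)) :
    ∀ m ≤ k, 0 < s.esymm m := by
  intro m
  induction m with
  | zero => intro _; rw [esymm_zero']; norm_num
  | succ m ih =>
    intro hm
    have h0 := ih (by omega)
    by_contra! hneg
    have h1 := h (m + 1) (by omega) (by omega)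
    have h2 := h (m + 2) (by omega) (by omega)
    rw [esymm_cons] at h1 h2
    have hn := newton_weak s m
    set x := s.esymm m
    set y := s.esymm (m + 1)
    set z := s.esymm (m + 2)
    have ha : 0 < a := by
      by_contra! ha
      nlinarith
    nlinarith [mul_pos h0 h2, mul_nonneg (neg_nonneg.2 hneg) h1.le]

/-- Log-concavity: by Newton's inequality the ratios of consecutive symmetric functions decrease as
long as the functions are positive. -/
theorem esymm_mul_le {s : Multiset ℝ} {l j : ℕ} (hlj : l ≤ j) (h : ∀ i ≤ j, 0 < s.esymm i) :
    s.esymm l * s.esymm (j + 1) ≤ s.esymm (l + 1) * s.esymm j := by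
  induction j, hlj using Nat.le_induction with
  | base => exact (mul_comm _ _).le
  | succ j hlj ih =>
    have h1 := ih fun i hi => h i (by omega)
    have h2 := newton_weak s j
    have hj := h j (by omega)
    have hj1 := h (j + 1) le_rfl
    have hl := h l (by omega)
    refine le_of_mul_le_mul_left ?_ hj
    calc s.esymm j * (s.esymm l * s.esymm (j + 1 + 1))
        = s.esymm l * (s.esymm j * s.esymm (j + 2)) := by ring
      _ ≤ s.esymm l * s.esymm (j + 1) ^ 2 := by gcongr
      _ = s.esymm (j + 1) * (s.esymm l * s.esymm (j + 1)) := by ring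
      _ ≤ s.esymm (j + 1) * (s.esymm (l + 1) * s.esymm j) := by gcongr
      _ = s.esymm j * (s.esymm (l + 1) * s.esymm (j + 1)) := by ring

/-! ### The mixed Hessian operator on diagonal matrices -/

/-- The elementary symmetric function `σ_m(λ)` of a tuple. -/
def esym {n : ℕ} (m : ℕ) (lam : Fin n → ℝ) : ℝ := (Finset.univ.val.map lam).esymm m

/-- The elementary symmetric function of a tuple with its `i`-th entry removed. -/
def esymErase {n : ℕ} (m : ℕ) (lam : Fin n → ℝ) (i : Fin n) : ℝ :=
  ((Finset.univ.erase i).val.map lam).esymm m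

theorem map_univ_eq_cons {n : ℕ} (lam : Fin n → ℝ) (i : Fin n) :
    Finset.univ.val.map lam = lam i ::ₘ (Finset.univ.erase i).val.map lam := by
  rw [← Multiset.map_cons, ← Finset.cons_val (Finset.notMem_erase i _), Finset.cons_eq_insert,
    Finset.insert_erase (Finset.mem_univ i)]

theorem esym_succ {n : ℕ} (m : ℕ) (lam : Fin n → ℝ) (i : Fin n) :
    esym (m + 1) lam = esymErase (m + 1) lam i + lam i * esymErase m lam i := by
  rw [esym, map_univ_eq_cons lam i, esymm_cons]; rfl

theorem esym_zero {n : ℕ} (lam : Fin n → ℝ) : esym 0 lam = 1 := esymm_zero' _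

theorem esymErase_zero {n : ℕ} (lam : Fin n → ℝ) (i : Fin n) : esymErase 0 lam i = 1 :=
  esymm_zero' _

theorem coeff_prod_erase {n : ℕ} (lam : Fin n → ℝ) (i : Fin n) {m : ℕ} (hm : m < n) :
    (∏ j ∈ Finset.univ.erase i, (Polynomial.X + Polynomial.C (lam j))).coeff (n - 1 - m)
      = esymErase m lam i := by
  have hc : Multiset.card (Finset.univ.erase i).val = n - 1 := by
    rw [Finset.card_val, Finset.card_erase_of_mem (Finset.mem_univ i), Finset.card_fin]
  rw [Finset.prod, Multiset.prod_X_add_C_coeff' _ lam (by omega), hc,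
    show n - 1 - (n - 1 - m) = m by omega]
  rfl

/-- Compare coefficients in the product rule for the derivative of ∏(X + λ_j). -/
theorem sum_esymErase {n : ℕ} (lam : Fin n → ℝ) {m : ℕ} (hm : m < n) :
    ∑ i, esymErase m lam i = (n - m) * esym m lam := by
  have hc : Multiset.card (Finset.univ : Finset (Fin n)).val = n := by simp
  have h := congrArg (fun p => Polynomial.coeff p (n - 1 - m))
    (Polynomial.derivative_prod_finset (s := Finset.univ)
      (f := fun j : Fin n => Polynomial.X + Polynomial.C (lam j)))
  simp only [Polynomial.coeff_derivative, Polynomial.derivative_add, Polynomial.derivative_X,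
    Polynomial.derivative_C, add_zero, mul_one, Polynomial.finsetSum_coeff,
    coeff_prod_erase lam _ hm] at h
  rw [← h, Finset.prod, Multiset.prod_X_add_C_coeff' _ lam (by omega), hc,
    show n - (n - 1 - m + 1) = m by omega, esym]
  have : ((n - 1 - m : ℕ) : ℝ) + 1 = n - m := by
    rw [Nat.sub_sub, Nat.cast_sub (by omega)]; push_cast; ring
  rw [this, mul_comm]

theorem sum_mul_esymErase {n : ℕ} (lam : Fin n → ℝ) {m : ℕ} (hm : m < n) :
    ∑ i, lam i * esymErase m lam i = (m + 1) * esym (m + 1) lam := by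
  have h1 : ∑ i : Fin n, esym (m + 1) lam = n * esym (m + 1) lam := by simp
  have h2 : ∑ i, esymErase (m + 1) lam i = (n - (m + 1)) * esym (m + 1) lam := by
    rcases (Nat.succ_le_of_lt hm).lt_or_eq with h | h
    · have := sum_esymErase lam h
      push_cast at this
      exact this
    · have hc : (n : ℝ) - (m + 1) = 0 := by rw [← h]; push_cast; ring
      rw [hc, zero_mul]
      refine Finset.sum_eq_zero fun i _ => esymm_eq_zero ?_
      rw [Multiset.card_map, Finset.card_val, Finset.card_erase_of_mem (Finset.mem_univ i),
        Finset.card_fin]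
      omega
  have h3 : ∑ i : Fin n, esym (m + 1) lam
      = ∑ i, esymErase (m + 1) lam i + ∑ i, lam i * esymErase m lam i := by
    rw [← Finset.sum_add_distrib]
    exact Finset.sum_congr rfl fun i _ => esym_succ m lam i
  rw [h1, h2] at h3
  linarith

/-- The partial derivative `∂σ_m/∂λ_i`. -/
def esymDeriv {n : ℕ} (m : ℕ) (lam : Fin n → ℝ) (i : Fin n) : ℝ :=
  match m with
  | 0 => 0
  | m + 1 => esymErase m lam i

theorem esym_eq {n : ℕ} (m : ℕ) (lam : Fin n → ℝ) (i : Fin n) :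
    esym m lam = esymErase m lam i + lam i * esymDeriv m lam i := by
  cases m with
  | zero => simp [esym_zero, esymErase_zero, esymDeriv]
  | succ m => exact esym_succ m lam i

theorem sum_mul_esymDeriv {n : ℕ} (lam : Fin n → ℝ) {m : ℕ} (hm : m ≤ n) :
    ∑ i, lam i * esymDeriv m lam i = m * esym m lam := by
  cases m with
  | zero => simp [esymDeriv]
  | succ m =>
    have := sum_mul_esymErase lam (m := m) (by omega)
    push_cast
    exact this

section MixedOperator

variable {n k : ℕ} {lam : Fin n → ℝ} {α : Fin k → ℝ} {a A : ℝ}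

/-- The diagonal entries of the linearization of `σ_k - ∑_{l<k} α_l σ_l` at a diagonal matrix. -/
def mixedCoeff (α : Fin k → ℝ) (lam : Fin n → ℝ) (i : Fin n) : ℝ :=
  esymDeriv k lam i - ∑ l : Fin k, α l * esymDeriv (l : ℕ) lam i

theorem esymErase_pos (hpos : ∀ m ≤ k, 0 < esym m lam) (i : Fin n) {m : ℕ} (hm : m < k) :
    0 < esymErase m lam i := by
  obtain ⟨j, rfl⟩ : ∃ j, k = j + 1 := ⟨k - 1, by omega⟩
  have : lam i ::ₘ (Finset.univ.erase i).val.map lam ∈ gardingCone (j + 1) := by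
    rw [← map_univ_eq_cons]
    exact fun m _ h2 => hpos m h2
  exact esymm_pos_of_cons this m (by omega)

/-- In other words σ_k/σ_l is nondecreasing in λ_i. Once both functions are written as affine
functions of λ_i, the λ_i terms cancel, and what remains is log-concavity for the tuple without λ_i.
-/
theorem esym_mul_esymDeriv_le (hpos : ∀ m ≤ k, 0 < esym m lam) (i : Fin n) {l : ℕ}
    (hl : l < k) : esymDeriv l lam i * esym k lam ≤ esym l lam * esymDeriv k lam i := by
  have key : esymDeriv l lam i * esymErase k lam i ≤ esymErase l lam i * esymDeriv k lam i := by
    obtain ⟨j, rfl⟩ : ∃ j, k = j + 1 := ⟨k - 1, by omega⟩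
    cases l with
    | zero =>
      have h0 := esymErase_pos hpos i (m := 0) (by omega)
      have h1 := esymErase_pos hpos i (m := j) (by omega)
      simp only [esymDeriv, zero_mul]
      positivity
    | succ l =>
      exact esymm_mul_le (l := l) (j := j) (by omega)
        fun m hm => esymErase_pos hpos i (by omega)
  rw [esym_eq k lam i, esym_eq l lam i]
  linarith

/-- Replacing σ_k by ∑ α_l σ_l in the first term turns the linearization into a sum of cross
differences, each of which is nonnegative; ellipticity follows. -/
theorem mixedCoeff_mul (heq : esym k lam = ∑ l : Fin k, α l * esym l lam) (i : Fin n) :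
    mixedCoeff α lam i * esym k lam
      = ∑ l : Fin k, α l * (esym l lam * esymDeriv k lam i - esymDeriv l lam i * esym k lam) := by
  simp only [mul_sub, Finset.sum_sub_distrib, sub_mul, mixedCoeff, Finset.sum_mul]
  congr 1
  · nth_rewrite 1 [heq]
    rw [mul_comm, Finset.sum_mul]
    exact Finset.sum_congr rfl fun l _ => by ring
  · exact Finset.sum_congr rfl fun l _ => by ring

theorem mixedCoeff_nonneg (hpos : ∀ m ≤ k, 0 < esym m lam) (hα : ∀ l, 0 ≤ α l)
    (heq : esym k lam = ∑ l : Fin k, α l * esym l lam) (i : Fin n) :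
    0 ≤ mixedCoeff α lam i := by
  refine nonneg_of_mul_nonneg_left ?_ (hpos k le_rfl)
  rw [mixedCoeff_mul heq]
  exact Finset.sum_nonneg fun l _ =>
    mul_nonneg (hα l) (sub_nonneg.2 (esym_mul_esymDeriv_le hpos i l.2))

/-- If σ_k exceeded σ_{k-1}, log-concavity would make σ_l nondecreasing for l ≤ k, and the equation
would give σ_k ≤ kA σ_{k-1}. The constant 1 + kA covers both cases. -/
theorem esym_le_of_equation {j : ℕ} {α : Fin (j + 1) → ℝ} (hpos : ∀ m ≤ j + 1, 0 < esym m lam)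
    (hα0 : ∀ l, 0 ≤ α l) (hαA : ∀ l, α l ≤ A)
    (heq : esym (j + 1) lam = ∑ l : Fin (j + 1), α l * esym l lam) :
    esym (j + 1) lam ≤ (1 + (j + 1) * A) * esym j lam := by
  have hA : 0 ≤ A := (hα0 0).trans (hαA 0)
  have hjpos := hpos j (by omega)
  by_contra! hlt
  have hlt1 : esym j lam < esym (j + 1) lam := by
    have : 0 ≤ ((j : ℝ) + 1) * A * esym j lam := by positivity
    nlinarith
  have hstep : ∀ l < j, esym l lam ≤ esym (l + 1) lam := by
    intro l hl
    have h1 : esym l lam * esym (j + 1) lam ≤ esym (l + 1) lam * esym j lam :=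
      esymm_mul_le hl.le fun m hm => hpos m (by omega)
    have h2 := hpos (l + 1) (by omega)
    refine le_of_mul_le_mul_right (h1.trans ?_) (hpos (j + 1) le_rfl)
    gcongr
  have hle : ∀ l ≤ j, esym l lam ≤ esym j lam := fun l hl =>
    Nat.decreasingInduction (motive := fun l _ => esym l lam ≤ esym j lam)
      (fun m hm ih => (hstep m hm).trans ih) le_rfl hl
  have : esym (j + 1) lam ≤ ∑ l : Fin (j + 1), A * esym j lam := by
    rw [heq]
    refine Finset.sum_le_sum fun l _ => ?_
    exact mul_le_mul (hαA l) (hle l (by omega)) (hpos l (by omega)).le hA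
  rw [Finset.sum_const, Finset.card_fin, nsmul_eq_mul] at this
  push_cast at this
  nlinarith

/-- Only the summand l = k-1 of `mixedCoeff_mul` is kept. Summed over i, it is a gap in Newton's
inequality; the sharp constant is essential here, since it leaves at least σ_{k-1}²/k. -/
theorem le_sum_mixedCoeff_mul {q : ℕ} {α : Fin (q + 2) → ℝ} (hkn : q + 2 ≤ n)
    (hpos : ∀ m ≤ q + 2, 0 < esym m lam) (ha : 0 < a) (hα : ∀ l, a ≤ α l)
    (heq : esym (q + 2) lam = ∑ l : Fin (q + 2), α l * esym l lam) :
    a / (q + 2) * esym (q + 1) lam ^ 2 ≤ (∑ i, mixedCoeff α lam i) * esym (q + 2) lam := by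
  obtain ⟨d, rfl⟩ := Nat.exists_eq_add_of_le hkn
  have hN := newton_sharp q d (Finset.univ.val.map lam) (by simp)
  have h1 : ∑ i, esymErase (q + 1) lam i = (d + 1) * esym (q + 1) lam := by
    rw [sum_esymErase lam (by omega)]; push_cast; ring
  have h2 : ∑ i, esymErase q lam i = (d + 2) * esym q lam := by
    rw [sum_esymErase lam (by omega)]; push_cast; ring
  have h3 : ∑ i, (esym (q + 1) lam * esymDeriv (q + 2) lam i
        - esymDeriv (q + 1) lam i * esym (q + 2) lam)
      = (d + 1) * esym (q + 1) lam ^ 2 - (d + 2) * (esym q lam * esym (q + 2) lam) := by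
    rw [Finset.sum_sub_distrib, ← Finset.mul_sum, ← Finset.sum_mul]
    simp only [esymDeriv]
    rw [h1, h2]
    ring
  have h4 : 1 / (q + 2 : ℝ) * esym (q + 1) lam ^ 2
      ≤ (d + 1) * esym (q + 1) lam ^ 2 - (d + 2) * (esym q lam * esym (q + 2) lam) := by
    have hq : (0 : ℝ) < q + 2 := by positivity
    have hd : (0 : ℝ) ≤ d := Nat.cast_nonneg d
    rw [div_mul_eq_mul_div, one_mul, div_le_iff₀ hq]
    have hs := sq_nonneg (esym (q + 1) lam)
    change (q + 2 : ℝ) * (d + 2) * (esym q lam * esym (q + 2) lam) ≤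
      (q + 1) * (d + 1) * esym (q + 1) lam ^ 2 at hN
    nlinarith
  have hterm : ∀ i, a * (esym (q + 1) lam * esymDeriv (q + 2) lam i
        - esymDeriv (q + 1) lam i * esym (q + 2) lam) ≤ mixedCoeff α lam i * esym (q + 2) lam := by
    intro i
    rw [mixedCoeff_mul heq]
    have hnn : ∀ l : Fin (q + 2),
        0 ≤ esym l lam * esymDeriv (q + 2) lam i - esymDeriv l lam i * esym (q + 2) lam :=
      fun l => sub_nonneg.2 (esym_mul_esymDeriv_le hpos i l.2)
    have := Finset.single_le_sum (f := fun l : Fin (q + 2) => α l *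
      (esym l lam * esymDeriv (q + 2) lam i - esymDeriv l lam i * esym (q + 2) lam))
      (fun l _ => mul_nonneg (ha.le.trans (hα l)) (hnn l)) (Finset.mem_univ (Fin.last (q + 1)))
    refine le_trans ?_ this
    exact mul_le_mul_of_nonneg_right (hα _) (hnn (Fin.last (q + 1)))
  calc a / (q + 2) * esym (q + 1) lam ^ 2
      = a * (1 / (q + 2 : ℝ) * esym (q + 1) lam ^ 2) := by ring
    _ ≤ a * _ := mul_le_mul_of_nonneg_left h4 ha.le
    _ = ∑ i, a * (esym (q + 1) lam * esymDeriv (q + 2) lam i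
        - esymDeriv (q + 1) lam i * esym (q + 2) lam) := by rw [← h3, Finset.mul_sum]
    _ ≤ _ := by rw [Finset.sum_mul]; exact Finset.sum_le_sum fun i _ => hterm i

/-- The trace of the linearized operator controls all lower order symmetric functions. -/
theorem sum_esym_le (hk : 2 ≤ k) (hkn : k ≤ n) (hpos : ∀ m ≤ k, 0 < esym m lam) (ha : 0 < a)
    (hαa : ∀ l, a ≤ α l) (hαA : ∀ l, α l ≤ A)
    (heq : esym k lam = ∑ l : Fin k, α l * esym l lam) :
    ∑ l : Fin k, esym l lam ≤ (k * (1 + k * A) / a) ^ 2 * ∑ i, mixedCoeff α lam i := by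
  obtain ⟨q, rfl⟩ : ∃ q, k = q + 2 := ⟨k - 2, by omega⟩
  have hα0 : ∀ l, 0 ≤ α l := fun l => ha.le.trans (hαa l)
  have hA : 0 ≤ A := (hα0 0).trans (hαA 0)
  have hR := esym_le_of_equation hpos hα0 hαA heq
  have htr := le_sum_mixedCoeff_mul hkn hpos ha hαa heq
  set T := ∑ i, mixedCoeff α lam i
  have hT : 0 ≤ T := Finset.sum_nonneg fun i _ => mixedCoeff_nonneg hpos hα0 heq i
  set R : ℝ := 1 + (((q + 2 : ℕ) : ℝ)) * A with hRdef
  have hR' : esym (q + 2) lam ≤ R * esym (q + 1) lam := by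
    convert hR using 2
    rw [hRdef]; push_cast; ring
  have hRpos : 0 < R := by positivity
  have hs1 := hpos (q + 1) (by omega)
  have hq : (0 : ℝ) < q + 2 := by positivity
  -- Combine (a/k)σ_{k-1}² ≤ Tσ_k with σ_k ≤ Rσ_{k-1} and cancel σ_{k-1}.
  have h1 : esym (q + 1) lam ≤ ((q + 2 : ℕ) : ℝ) * R / a * T := by
    have h2 : a / (q + 2) * esym (q + 1) lam ^ 2 ≤ T * (R * esym (q + 1) lam) :=
      htr.trans (by gcongr)
    have h3 : a / (q + 2) * esym (q + 1) lam ≤ T * R := by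
      refine le_of_mul_le_mul_right ?_ hs1
      linarith
    rw [div_mul_eq_mul_div, div_le_iff₀ hq] at h3
    rw [div_mul_eq_mul_div, le_div_iff₀ ha]
    push_cast
    linarith
  -- Each a σ_l is at most α_l σ_l, one nonnegative summand of σ_k.
  have hl : ∀ l : Fin (q + 2), esym l lam ≤ R / a * esym (q + 1) lam := by
    intro l
    rw [div_mul_eq_mul_div, le_div_iff₀ ha]
    have hnn : ∀ l : Fin (q + 2), 0 ≤ α l * esym l lam :=
      fun l => mul_nonneg (hα0 l) (hpos l (by omega)).le
    have := Finset.single_le_sum (fun l _ => hnn l) (Finset.mem_univ l)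
    rw [← heq] at this
    have h5 : a * esym l lam ≤ α l * esym l lam :=
      mul_le_mul_of_nonneg_right (hαa l) (hpos l (by omega)).le
    linarith
  calc ∑ l : Fin (q + 2), esym l lam ≤ ∑ l : Fin (q + 2), R / a * esym (q + 1) lam :=
        Finset.sum_le_sum fun l _ => hl l
    _ = ((q + 2 : ℕ) : ℝ) * R / a * esym (q + 1) lam := by
        rw [Finset.sum_const, Finset.card_fin, nsmul_eq_mul]; ring
    _ ≤ ((q + 2 : ℕ) : ℝ) * R / a * (((q + 2 : ℕ) : ℝ) * R / a * T) := by gcongr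
    _ = _ := by ring

/-- By Euler's identity and the equation, the sum equals ∑ (k - l) α_l σ_l. -/
theorem abs_sum_mul_mixedCoeff_le (hkn : k ≤ n) (hpos : ∀ m ≤ k, 0 < esym m lam)
    (hα0 : ∀ l, 0 ≤ α l) (hαA : ∀ l, α l ≤ A)
    (heq : esym k lam = ∑ l : Fin k, α l * esym l lam) :
    |∑ i, lam i * mixedCoeff α lam i| ≤ k * A * ∑ l : Fin k, esym l lam := by
  have h1 : ∑ i, lam i * mixedCoeff α lam i
      = ∑ l : Fin k, (k - (l : ℕ)) * (α l * esym l lam) := by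
    simp only [mixedCoeff, mul_sub, Finset.sum_sub_distrib, Finset.mul_sum]
    rw [sum_mul_esymDeriv lam hkn, Finset.sum_comm]
    have : ∀ l : Fin k, ∑ i, lam i * (α l * esymDeriv l lam i) = l * (α l * esym l lam) := by
      intro l
      rw [mul_left_comm, ← sum_mul_esymDeriv lam (l.2.le.trans hkn), Finset.mul_sum]
      exact Finset.sum_congr rfl fun i _ => by ring
    simp only [this, sub_mul, Finset.sum_sub_distrib]
    rw [heq, Finset.mul_sum]
  have hnn : ∀ l : Fin k, 0 ≤ esym l lam := fun l => (hpos l l.2.le).le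
  have hkl : ∀ l : Fin k, (0 : ℝ) ≤ k - (l : ℕ) := fun l =>
    sub_nonneg.2 (by exact_mod_cast l.2.le)
  rw [h1, abs_of_nonneg (Finset.sum_nonneg fun l _ =>
    mul_nonneg (hkl l) (mul_nonneg (hα0 l) (hnn l))), Finset.mul_sum]
  refine Finset.sum_le_sum fun l _ => ?_
  rw [mul_assoc]
  have hl0 : (0 : ℝ) ≤ (l : ℕ) := Nat.cast_nonneg _
  have := hnn l
  have := hα0 l
  have := hαA l
  gcongr
  linarith

/-- A solution of the diagonal equation cannot have only large entries. -/
theorem exists_lt_of_equation (hk : 2 ≤ k) (hkn : k ≤ n) (hpos : ∀ m ≤ k, 0 < esym m lam)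
    (hα0 : ∀ l, 0 ≤ α l) (hαA : ∀ l, α l ≤ A)
    (heq : esym k lam = ∑ l : Fin k, α l * esym l lam) {β : ℝ} (hβ : k * (1 + k * A) < β) :
    ∃ i, lam i < β := by
  by_contra! hall
  obtain ⟨j, rfl⟩ : ∃ j, k = j + 1 := ⟨k - 1, by omega⟩
  have hR := esym_le_of_equation hpos hα0 hαA heq
  have h1 := sum_mul_esymErase lam (m := j) (by omega)
  have h2 := sum_esymErase lam (m := j) (by omega)
  have hA : 0 ≤ A := (hα0 0).trans (hαA 0)
  have hβ0 : 0 < β := lt_of_le_of_lt (by positivity) hβ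
  -- If all λ_i ≥ β, Euler's identity gives kσ_k ≥ β(n-k+1)σ_{k-1}, too large for σ_k ≤ (1 +
  -- kA)σ_{k-1}.
  have h3 : β * ∑ i, esymErase j lam i ≤ ∑ i, lam i * esymErase j lam i := by
    rw [Finset.mul_sum]
    exact Finset.sum_le_sum fun i _ =>
      mul_le_mul_of_nonneg_right (hall i) (esymErase_pos hpos i (by omega)).le
  rw [h1, h2] at h3
  have hs := hpos j (by omega)
  have hnj : (1 : ℝ) ≤ n - j := by
    have : ((j + 1 : ℕ) : ℝ) ≤ n := by exact_mod_cast hkn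
    push_cast at this; linarith
  have h4 : β * esym j lam ≤ β * ((n - j) * esym j lam) := by
    gcongr; nlinarith
  push_cast at hβ
  have h5 : ((j : ℝ) + 1) * esym (j + 1) lam ≤ (j + 1) * ((1 + (j + 1) * A) * esym j lam) := by
    gcongr
  have h6 := mul_lt_mul_of_pos_right hβ hs
  nlinarith

end MixedOperator

/-! ### Derivatives of the symmetric functions of a Hessian -/

/-- Only the identity permutation contributes: any other moves at least two indices, so after one
factor is differentiated a vanishing off-diagonal entry remains. -/
theorem hasDerivAt_det_diagonal {n : ℕ} {M : ℝ → Matrix (Fin n) (Fin n) ℝ}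
    {B : Matrix (Fin n) (Fin n) ℝ} {d : Fin n → ℝ}
    (hM : ∀ i j, HasDerivAt (fun t => M t i j) (B i j) 0) (h0 : M 0 = Matrix.diagonal d) :
    HasDerivAt (fun t => (M t).det) (∑ i, B i i * ∏ j ∈ Finset.univ.erase i, d j) 0 := by
  have h1 : HasDerivAt (fun t => (M t).det)
      (∑ σ : Equiv.Perm (Fin n), ((Equiv.Perm.sign σ : ℤ) : ℝ) *
        ∑ i, (∏ j ∈ Finset.univ.erase i, M 0 (σ j) j) • B (σ i) i) 0 := by
    simp only [Matrix.det_apply']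
    exact HasDerivAt.fun_sum fun σ _ =>
      (HasDerivAt.fun_finsetProd fun i _ => hM (σ i) i).const_mul _
  refine h1.congr_deriv ?_
  symm
  rw [Finset.sum_eq_single (1 : Equiv.Perm (Fin n))]
  · simp only [Equiv.Perm.sign_one, Units.val_one, Int.cast_one, one_mul, Equiv.Perm.one_apply,
      smul_eq_mul, h0]
    refine Finset.sum_congr rfl fun i _ => ?_
    rw [mul_comm]
    congr 1
    exact Finset.prod_congr rfl fun j _ => (Matrix.diagonal_apply_eq d j).symm
  · intro σ _ hσ
    rw [Finset.sum_eq_zero, mul_zero]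
    intro i _
    obtain ⟨j, hj, hji⟩ : ∃ j ∈ σ.support, j ≠ i := by
      by_contra! hcon
      refine hσ (Equiv.Perm.card_support_le_one.1 (Finset.card_le_one.2 fun x hx y hy => ?_))
      rw [hcon x hx, hcon y hy]
    rw [Finset.prod_eq_zero (Finset.mem_erase.2 ⟨hji, Finset.mem_univ j⟩), zero_smul]
    rw [h0, Matrix.diagonal_apply_ne]
    exact Equiv.Perm.mem_support.1 hj
  · simp

/-- By Lagrange interpolation a coefficient is a fixed linear combination of values, so
differentiating the characteristic polynomial reduces to differentiating determinants. -/
theorem exists_coeff_eq_sum_eval (n j : ℕ) : ∃ v w : Fin (n + 1) → ℝ,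
    ∀ p : Polynomial ℝ, p.natDegree ≤ n → p.coeff j = ∑ i, w i * p.eval (v i) := by
  refine ⟨fun i => (i : ℕ), fun i =>
    (Lagrange.basis Finset.univ (fun i : Fin (n + 1) => ((i : ℕ) : ℝ)) i).coeff j, fun p hp => ?_⟩
  have hinj : Set.InjOn (fun i : Fin (n + 1) => ((i : ℕ) : ℝ)) ↑(Finset.univ : Finset (Fin (n + 1))) := by
    intro x _ y _ hxy
    exact Fin.ext (Nat.cast_injective hxy)
  have := Lagrange.eq_interpolate (f := p) hinj
    (by
      rw [Finset.card_fin]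
      exact lt_of_le_of_lt Polynomial.degree_le_natDegree (by exact_mod_cast Nat.lt_succ_of_le hp))
  conv_lhs => rw [this]
  rw [Lagrange.interpolate_apply, Polynomial.finsetSum_coeff]
  exact Finset.sum_congr rfl fun i _ => by rw [Polynomial.coeff_C_mul, mul_comm]

theorem hasDerivAt_charpoly_coeff {n : ℕ} {M : ℝ → Matrix (Fin n) (Fin n) ℝ}
    {B : Matrix (Fin n) (Fin n) ℝ} {d : Fin n → ℝ}
    (hM : ∀ i j, HasDerivAt (fun t => M t i j) (B i j) 0) (h0 : M 0 = Matrix.diagonal d) (j : ℕ) :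
    HasDerivAt (fun t => (M t).charpoly.coeff j)
      (-∑ i, B i i * (∏ l ∈ Finset.univ.erase i,
        (Polynomial.X - Polynomial.C (d l))).coeff j) 0 := by
  obtain ⟨v, w, hvw⟩ := exists_coeff_eq_sum_eval n j
  have heval : ∀ z : ℝ, HasDerivAt (fun t => (M t).charpoly.eval z)
      (-∑ i, B i i * ∏ l ∈ Finset.univ.erase i, (z - d l)) 0 := by
    intro z
    simp only [Matrix.eval_charpoly]
    have := hasDerivAt_det_diagonal (M := fun t => Matrix.scalar (Fin n) z - M t) (B := -B)
      (d := fun l => z - d l)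
      (fun i l => by
        simpa using (hM i l).const_sub (Matrix.scalar (Fin n) z i l))
      (by
        rw [h0]
        ext i l
        by_cases hil : i = l <;> simp [hil])
    simpa [Finset.sum_neg_distrib] using this
  have hfun : (fun t => (M t).charpoly.coeff j)
      = fun t => ∑ i, w i * (M t).charpoly.eval (v i) := by
    funext t
    exact hvw _ (by rw [Matrix.charpoly_natDegree_eq_dim, Fintype.card_fin])
  rw [hfun]
  have hd := HasDerivAt.fun_sum (u := Finset.univ) fun i _ => (heval (v i)).const_mul (w i)
  refine hd.congr_deriv ?_
  symm
  have hdeg : ∀ i : Fin n, (∏ l ∈ Finset.univ.erase i,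
      (Polynomial.X - Polynomial.C (d l))).natDegree ≤ n := by
    intro i
    rw [Polynomial.natDegree_finsetProd_X_sub_C_eq_card]
    exact (Finset.card_le_univ _).trans (by simp)
  have hco := fun i => hvw _ (hdeg i)
  simp only [mul_neg, Finset.sum_neg_distrib, hco, Polynomial.eval_prod,
    Polynomial.eval_sub, Polynomial.eval_X, Polynomial.eval_C, Finset.mul_sum]
  rw [Finset.sum_comm]
  congr 1
  exact Finset.sum_congr rfl fun i _ => Finset.sum_congr rfl fun l _ => by ring

/-- The operator representing a continuous bilinear form. -/
def formOp {n : ℕ} (H : E n →L[ℝ] E n →L[ℝ] ℝ) : E n →ₗ[ℝ] E n :=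
  (InnerProductSpace.toDual ℝ (E n)).symm.toLinearEquiv.toLinearMap ∘ₗ H.toLinearMap

theorem inner_formOp {n : ℕ} (H : E n →L[ℝ] E n →L[ℝ] ℝ) (v w : E n) :
    ⟪formOp H v, w⟫ = H v w :=
  InnerProductSpace.toDual_symm_apply

/-- The matrix of a bilinear form in an orthonormal basis. -/
def formMatrix {n : ℕ} (H : E n →L[ℝ] E n →L[ℝ] ℝ) (e : OrthonormalBasis (Fin n) ℝ (E n)) :
    Matrix (Fin n) (Fin n) ℝ :=
  Matrix.of fun i j => H (e i) (e j)

theorem charpoly_formMatrix {n : ℕ} (H : E n →L[ℝ] E n →L[ℝ] ℝ)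
    (e : OrthonormalBasis (Fin n) ℝ (E n)) :
    (formMatrix H e).charpoly = (formOp H).charpoly := by
  rw [← LinearMap.charpoly_toMatrix (formOp H) e.toBasis, ← Matrix.charpoly_transpose]
  congr 1
  ext i j
  rw [Matrix.transpose_apply, LinearMap.toMatrix_apply, OrthonormalBasis.coe_toBasis_repr_apply,
    OrthonormalBasis.repr_apply_apply, OrthonormalBasis.coe_toBasis, real_inner_comm,
    inner_formOp]
  rfl

theorem charpoly_hessian {n : ℕ} (u : E n → ℝ) (x : E n)
    (e : OrthonormalBasis (Fin n) ℝ (E n)) :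
    (hessian u x).charpoly = (formMatrix (fderiv ℝ (fderiv ℝ u) x) e).charpoly := by
  rw [charpoly_formMatrix, ← charpoly_formMatrix _ (EuclideanSpace.basisFun (Fin n) ℝ)]
  simp only [formMatrix, EuclideanSpace.basisFun_apply]
  rfl

theorem exists_formMatrix_eq_diagonal {n : ℕ} {H : E n →L[ℝ] E n →L[ℝ] ℝ}
    (hH : ∀ v w, H v w = H w v) : ∃ (e : OrthonormalBasis (Fin n) ℝ (E n)) (lam : Fin n → ℝ),
      formMatrix H e = Matrix.diagonal lam := by
  have hT : (formOp H).IsSymmetric := by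
    intro v w
    rw [inner_formOp, real_inner_comm, inner_formOp, hH]
  have hn : Module.finrank ℝ (E n) = n := finrank_euclideanSpace_fin
  refine ⟨hT.eigenvectorBasis hn, hT.eigenvalues hn, ?_⟩
  ext i j
  rw [formMatrix, Matrix.of_apply, ← inner_formOp, hT.apply_eigenvectorBasis, inner_smul_left,
    orthonormal_iff_ite.1 (hT.eigenvectorBasis hn).orthonormal i j, Matrix.diagonal_apply]
  simp

theorem eigenvalues_hessian {n : ℕ} {u : E n → ℝ} {x : E n}
    {e : OrthonormalBasis (Fin n) ℝ (E n)} {lam : Fin n → ℝ}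
    (h : formMatrix (fderiv ℝ (fderiv ℝ u) x) e = Matrix.diagonal lam) :
    eigenvalues (hessian u x) = Finset.univ.val.map lam := by
  rw [eigenvalues, charpoly_hessian u x e, h, Matrix.charpoly_diagonal]
  rw [← Polynomial.roots_multiset_prod_X_sub_C (Finset.univ.val.map lam), Multiset.map_map]
  rfl

theorem sigma_hessian {n : ℕ} {u : E n → ℝ} {x : E n}
    {e : OrthonormalBasis (Fin n) ℝ (E n)} {lam : Fin n → ℝ}
    (h : formMatrix (fderiv ℝ (fderiv ℝ u) x) e = Matrix.diagonal lam) (m : ℕ) :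
    sigma m (hessian u x) = esym m lam := by
  rw [sigma, eigenvalues_hessian h, esym]

/-- Individual eigenvalues need not be differentiable, but coefficients of the characteristic
polynomial are polynomial in the entries. Symmetry is needed so that all roots are real. -/
theorem sigma_hessian_eq_coeff {n : ℕ} {u : E n → ℝ} {x : E n}
    (hsymm : IsSymmSndFDerivAt ℝ u x) {m : ℕ} (hm : m ≤ n) :
    sigma m (hessian u x) = (-1) ^ m * (hessian u x).charpoly.coeff (n - m) := by
  obtain ⟨e, lam, h⟩ := exists_formMatrix_eq_diagonal hsymm
  have hd : (hessian u x).charpoly.natDegree = n := by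
    rw [Matrix.charpoly_natDegree_eq_dim, Fintype.card_fin]
  have hcard : Multiset.card (hessian u x).charpoly.roots
      = (hessian u x).charpoly.natDegree := by
    have := eigenvalues_hessian h
    rw [eigenvalues] at this
    rw [this, hd]
    simp
  rw [Polynomial.coeff_eq_esymm_roots_of_card hcard (by rw [hd]; omega), hd,
    (Matrix.charpoly_monic _).leadingCoeff, Nat.sub_sub_self hm, one_mul, ← mul_assoc,
    ← mul_pow]
  simp [sigma, eigenvalues]

theorem coeff_prod_sub_erase {n : ℕ} (lam : Fin n → ℝ) (i : Fin n) {m : ℕ} (hm : m < n) :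
    (∏ j ∈ Finset.univ.erase i, (Polynomial.X - Polynomial.C (lam j))).coeff (n - (m + 1))
      = (-1) ^ m * esymErase m lam i := by
  have hc : Multiset.card ((Finset.univ.erase i).val.map lam) = n - 1 := by
    rw [Multiset.card_map, Finset.card_val, Finset.card_erase_of_mem (Finset.mem_univ i),
      Finset.card_fin]
  have := Multiset.prod_X_sub_C_coeff ((Finset.univ.erase i).val.map lam) (k := n - (m + 1))
    (by omega)
  rw [hc, show n - 1 - (n - (m + 1)) = m by omega, Multiset.map_map] at this
  exact this

theorem minSmoothness_two_le_three : minSmoothness ℝ 2 ≤ 3 := by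
  rw [minSmoothness_of_isRCLikeNormedField]; norm_num

theorem hasDerivAt_line {n : ℕ} (x ξ : E n) (t : ℝ) :
    HasDerivAt (fun t : ℝ => x + t • ξ) ξ t := by
  simpa using ((hasDerivAt_id t).smul_const ξ).const_add x

theorem hasDerivAt_comp_line {n : ℕ} {F : Type*} [NormedAddCommGroup F] [NormedSpace ℝ F]
    {f : E n → F} {f' : E n →L[ℝ] F} {x : E n} (hf : HasFDerivAt f f' x) (ξ : E n) :
    HasDerivAt (fun t : ℝ => f (x + t • ξ)) (f' ξ) 0 := by
  have hx : HasFDerivAt f f' (x + (0 : ℝ) • ξ) := by simpa using hf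
  exact hx.comp_hasDerivAt 0 (hasDerivAt_line x ξ 0)

theorem tendsto_line {n : ℕ} (x ξ : E n) :
    Filter.Tendsto (fun t : ℝ => x + t • ξ) (𝓝 0) (𝓝 x) := by
  simpa using (hasDerivAt_line x ξ 0).continuousAt.tendsto

/-- The basis `e` is kept fixed along the line although it diagonalizes the Hessian only at x; this
suffices for a first derivative. -/
theorem hasDerivAt_sigma_hessian {n : ℕ} {u : E n → ℝ} {x : E n} (hu : ContDiffAt ℝ 3 u x)
    {e : OrthonormalBasis (Fin n) ℝ (E n)} {lam : Fin n → ℝ}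
    (h : formMatrix (fderiv ℝ (fderiv ℝ u) x) e = Matrix.diagonal lam) {m : ℕ} (hm : m ≤ n)
    (ξ : E n) :
    HasDerivAt (fun t : ℝ => sigma m (hessian u (x + t • ξ)))
      (∑ i, esymDeriv m lam i * fderiv ℝ (fderiv ℝ (fderiv ℝ u)) x ξ (e i) (e i)) 0 := by
  cases m with
  | zero => simpa [esymDeriv, sigma, esymm_zero'] using hasDerivAt_const (0 : ℝ) (1 : ℝ)
  | succ m =>
    have hev : ∀ᶠ t : ℝ in 𝓝 0, sigma (m + 1) (hessian u (x + t • ξ))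
        = (-1) ^ (m + 1) *
          (formMatrix (fderiv ℝ (fderiv ℝ u) (x + t • ξ)) e).charpoly.coeff (n - (m + 1)) := by
      filter_upwards [(tendsto_line x ξ).eventually (hu.eventually (by simp))] with t ht
      rw [sigma_hessian_eq_coeff (ht.isSymmSndFDerivAt minSmoothness_two_le_three) hm, charpoly_hessian _ _ e]
    refine HasDerivAt.congr_of_eventuallyEq ?_ hev
    have hdiff : HasFDerivAt (fderiv ℝ (fderiv ℝ u))
        (fderiv ℝ (fderiv ℝ (fderiv ℝ u)) x) x := by
      have h2 : ContDiffAt ℝ 2 (fderiv ℝ u) x := hu.fderiv_right (by norm_num)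
      have h1 : ContDiffAt ℝ 1 (fderiv ℝ (fderiv ℝ u)) x := h2.fderiv_right (by norm_num)
      exact (h1.differentiableAt (by norm_num)).hasFDerivAt
    have hent : ∀ i j, HasDerivAt
        (fun t : ℝ => formMatrix (fderiv ℝ (fderiv ℝ u) (x + t • ξ)) e i j)
        ((Matrix.of fun i j => fderiv ℝ (fderiv ℝ (fderiv ℝ u)) x ξ (e i) (e j) :
          Matrix (Fin n) (Fin n) ℝ) i j) 0 := by
      intro i j
      have h1 := hasDerivAt_comp_line (f := fderiv ℝ (fderiv ℝ u)) hdiff ξ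
      have h2 := (h1.clm_apply (hasDerivAt_const 0 (e i))).clm_apply (hasDerivAt_const 0 (e j))
      simpa [formMatrix] using h2
    have := (hasDerivAt_charpoly_coeff hent (by simpa using h) (n - (m + 1))).const_mul
      ((-1 : ℝ) ^ (m + 1))
    refine this.congr_deriv ?_
    rw [← Finset.sum_neg_distrib, Finset.mul_sum]
    refine Finset.sum_congr rfl fun i _ => ?_
    rw [coeff_prod_sub_erase lam i (by omega), Matrix.of_apply, esymDeriv]
    have hs : ((-1 : ℝ) ^ m) * (-1) ^ m = 1 := by rw [← mul_pow]; simp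
    rw [pow_succ]
    linear_combination (esymErase m lam i *
      fderiv ℝ (fderiv ℝ (fderiv ℝ u)) x ξ (e i) (e i)) * hs

/-- The Hessian of an admissible solution in an orthonormal eigenbasis. -/
theorem exists_eigenbasis {n k : ℕ} {Ω : Set (E n)} {α : Fin k → E n → ℝ} {u : E n → ℝ} {x : E n}
    (hx : x ∈ Ω) (hu : ContDiffAt ℝ 3 u x) (hadm : IsAdmissible k Ω u)
    (heq : ∀ x ∈ Ω, sigma k (hessian u x) = ∑ l : Fin k, α l x * sigma (l : ℕ) (hessian u x)) :
    ∃ (e : OrthonormalBasis (Fin n) ℝ (E n)) (lam : Fin n → ℝ),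
      formMatrix (fderiv ℝ (fderiv ℝ u) x) e = Matrix.diagonal lam ∧
      (∀ i, fderiv ℝ (fderiv ℝ u) x (e i) (e i) = lam i) ∧
      (∀ m ≤ k, 0 < esym m lam) ∧ esym k lam = ∑ l : Fin k, α l x * esym l lam := by
  obtain ⟨e, lam, h⟩ := exists_formMatrix_eq_diagonal
    (hu.isSymmSndFDerivAt minSmoothness_two_le_three)
  refine ⟨e, lam, h, fun i => ?_, fun m hm => ?_, ?_⟩
  · have := congrFun (congrFun h i) i
    rwa [Matrix.diagonal_apply_eq] at this
  · rcases Nat.eq_zero_or_pos m with rfl | hm0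
    · rw [esym_zero]; norm_num
    · have := hadm x hx m hm0 hm
      rwa [eigenvalues_hessian h] at this
  · have := heq x hx
    simpa only [sigma_hessian h] using this

/-- The constant in the linearized equation. -/
def linConst (k : ℕ) (a A : ℝ) : ℝ := k * A * (k * (1 + k * A) / a) ^ 2

/-- The linearized equation, normalized to have trace one. -/
theorem exists_linearized {n k : ℕ} (hk : 2 ≤ k) (hkn : k ≤ n) {Ω : Set (E n)} (hΩ : IsOpen Ω)
    {α : Fin k → E n → ℝ} {u : E n → ℝ} {a A : ℝ} (ha : 0 < a) {x : E n} (hx : x ∈ Ω)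
    (hu : ContDiffOn ℝ 3 u Ω) (hadm : IsAdmissible k Ω u)
    (heq : ∀ x ∈ Ω, sigma k (hessian u x) = ∑ l : Fin k, α l x * sigma (l : ℕ) (hessian u x))
    (hαa : ∀ l, a ≤ α l x) (hαA : ∀ l, α l x ≤ A) (hαd : ∀ l, DifferentiableAt ℝ (α l) x)
    (hαD : ∀ l, ‖fderiv ℝ (α l) x‖ ≤ A) :
    ∃ (e : OrthonormalBasis (Fin n) ℝ (E n)) (w : Fin n → ℝ), (∀ i, 0 ≤ w i) ∧ ∑ i, w i = 1 ∧
      |∑ i, w i * fderiv ℝ (fderiv ℝ u) x (e i) (e i)| ≤ linConst k a A ∧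
      ∀ ξ, |∑ i, w i * fderiv ℝ (fderiv ℝ (fderiv ℝ u)) x ξ (e i) (e i)|
        ≤ linConst k a A * ‖ξ‖ := by
  have hu3 : ContDiffAt ℝ 3 u x := hu.contDiffAt (hΩ.mem_nhds hx)
  obtain ⟨e, lam, h, hd, hpos, heqx⟩ := exists_eigenbasis hx hu3 hadm heq
  have hσ := sigma_hessian h
  have hα0 : ∀ l, 0 ≤ α l x := fun l => ha.le.trans (hαa l)
  have hA : 0 ≤ A := (norm_nonneg _).trans (hαD ⟨0, by omega⟩)
  have hF0 := mixedCoeff_nonneg hpos hα0 heqx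
  have hsum := sum_esym_le hk hkn hpos ha hαa hαA heqx
  have htrace := abs_sum_mul_mixedCoeff_le hkn hpos hα0 hαA heqx
  set F := mixedCoeff (fun l => α l x) lam
  set S := ∑ l : Fin k, esym l lam
  set T := ∑ i, F i
  have hS : 0 < S := Finset.sum_pos (fun l _ => hpos l l.2.le) ⟨⟨0, by omega⟩, Finset.mem_univ _⟩
  have hT0 : 0 ≤ T := Finset.sum_nonneg fun i _ => hF0 i
  -- The trace cannot vanish, because it dominates the positive sum S.
  have hT : 0 < T := by
    refine lt_of_le_of_ne hT0 fun h0 => ?_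
    rw [← h0, mul_zero] at hsum
    linarith
  have hdiv : ∀ g : Fin n → ℝ, ∑ i, F i / T * g i = (∑ i, F i * g i) / T := by
    intro g
    rw [Finset.sum_div]
    exact Finset.sum_congr rfl fun i _ => by ring
  have hbound : ∀ (g : Fin n → ℝ) (c : ℝ), 0 ≤ c → |∑ i, F i * g i| ≤ k * A * c * S →
      |∑ i, F i / T * g i| ≤ linConst k a A * c := by
    intro g c hc hg
    rw [hdiv, abs_div, abs_of_pos hT, div_le_iff₀ hT]
    refine hg.trans ?_
    calc k * A * c * S ≤ k * A * c * ((k * (1 + k * A) / a) ^ 2 * T) := by gcongr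
      _ = _ := by rw [linConst]; ring
  refine ⟨e, fun i => F i / T, fun i => div_nonneg (hF0 i) hT0, ?_, ?_, fun ξ => ?_⟩
  · rw [← Finset.sum_div, div_self hT.ne']
  · simp only [hd]
    have := hbound lam 1 zero_le_one ?_
    · simpa using this
    · simpa [mul_comm] using htrace
  · refine hbound _ _ (norm_nonneg ξ) ?_
    have hd1 := hasDerivAt_sigma_hessian hu3 h hkn ξ
    have hd2 := HasDerivAt.fun_sum (u := Finset.univ) fun (l : Fin k) _ =>
      (hasDerivAt_comp_line (hαd l).hasFDerivAt ξ).mul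
        (hasDerivAt_sigma_hessian hu3 h (m := l) (l.2.le.trans hkn) ξ)
    have hev : (fun t : ℝ => sigma k (hessian u (x + t • ξ))) =ᶠ[𝓝 0]
        fun t => ∑ l : Fin k, α l (x + t • ξ) * sigma (l : ℕ) (hessian u (x + t • ξ)) := by
      filter_upwards [(tendsto_line x ξ).eventually (hΩ.mem_nhds hx)] with t ht
      exact heq _ ht
    -- The equation differentiated in the direction ξ.
    have huniq := hd1.unique (hd2.congr_of_eventuallyEq hev)
    simp only [zero_smul, add_zero, hσ] at huniq
    have hFsum : ∑ i, F i * fderiv ℝ (fderiv ℝ (fderiv ℝ u)) x ξ (e i) (e i)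
        = ∑ l : Fin k, fderiv ℝ (α l) x ξ * esym l lam := by
      have hF : ∀ i, F i = esymDeriv k lam i - ∑ l : Fin k, α l x * esymDeriv (l : ℕ) lam i :=
        fun i => rfl
      simp only [hF, sub_mul, Finset.sum_sub_distrib, Finset.sum_mul]
      rw [huniq, Finset.sum_comm, ← Finset.sum_sub_distrib]
      refine Finset.sum_congr rfl fun l _ => ?_
      rw [Finset.mul_sum]
      simp only [mul_assoc]
      ring
    rw [hFsum]
    have hk1 : (1 : ℝ) ≤ k := by exact_mod_cast (by omega : 1 ≤ k)
    calc |∑ l : Fin k, fderiv ℝ (α l) x ξ * esym l lam|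
        ≤ ∑ l : Fin k, |fderiv ℝ (α l) x ξ * esym l lam| := Finset.abs_sum_le_sum_abs _ _
      _ ≤ ∑ l : Fin k, A * ‖ξ‖ * esym l lam := by
          refine Finset.sum_le_sum fun l _ => ?_
          have hl := (hpos l l.2.le).le
          rw [abs_mul, abs_of_nonneg hl]
          have : |fderiv ℝ (α l) x ξ| ≤ A * ‖ξ‖ :=
            ((fderiv ℝ (α l) x).le_opNorm ξ).trans (by gcongr; exact hαD l)
          gcongr
      _ = 1 * A * ‖ξ‖ * S := by rw [← Finset.mul_sum]; ring
      _ ≤ k * A * ‖ξ‖ * S := by gcongr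

/-! ### Second derivative tests -/

/-- If f'' were positive, 0 would also be a local minimum, so f would be locally constant. -/
theorem second_deriv_nonpos {f f' : ℝ → ℝ} {f'' : ℝ}
    (h1 : ∀ᶠ t in 𝓝 (0 : ℝ), HasDerivAt f (f' t) t) (h2 : HasDerivAt f' f'' 0)
    (hmax : IsLocalMax f 0) : f'' ≤ 0 := by
  by_contra! hpos
  have hd : deriv f =ᶠ[𝓝 0] f' := h1.mono fun t ht => ht.deriv
  have hdd : deriv (deriv f) 0 = f'' := hd.deriv_eq.trans h2.deriv
  have hmin : IsLocalMin f 0 :=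
    isLocalMin_of_deriv_deriv_pos (hdd ▸ hpos) hmax.deriv_eq_zero h1.self_of_nhds.continuousAt
  have hconst : f =ᶠ[𝓝 0] fun _ => f 0 := by
    filter_upwards [hmax, hmin] with t ht1 ht2 using le_antisymm ht1 ht2
  have hzero : deriv f =ᶠ[𝓝 0] fun _ => 0 := by
    filter_upwards [hconst.deriv] with t ht
    simpa using ht
  have := hzero.deriv_eq
  rw [hdd] at this
  simp at this
  exact hpos.ne' this

theorem hasDerivAt_comp_line' {n : ℕ} {F : Type*} [NormedAddCommGroup F] [NormedSpace ℝ F]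
    {f : E n → F} {f' : E n →L[ℝ] F} {x ξ : E n} {t : ℝ} (hf : HasFDerivAt f f' (x + t • ξ)) :
    HasDerivAt (fun t : ℝ => f (x + t • ξ)) (f' ξ) t :=
  hf.comp_hasDerivAt t (hasDerivAt_line x ξ t)

theorem isLocalMax_comp_line {n : ℕ} {g : E n → ℝ} {x : E n} (h : IsLocalMax g x) (ξ : E n) :
    IsLocalMax (fun t : ℝ => g (x + t • ξ)) 0 := by
  have := (tendsto_line x ξ).eventually h
  filter_upwards [this] with t ht
  simpa using ht

/-- `C²` functions are differentiable near the point and so is their derivative at the point. -/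
theorem eventually_hasFDerivAt {n : ℕ} {F : Type*} [NormedAddCommGroup F] [NormedSpace ℝ F]
    {f : E n → F} {x : E n} (hf : ContDiffAt ℝ 2 f x) :
    ∀ᶠ y in 𝓝 x, HasFDerivAt f (fderiv ℝ f y) y := by
  filter_upwards [hf.eventually (by simp)] with y hy
  exact (hy.differentiableAt (by norm_num)).hasFDerivAt

theorem hasFDerivAt_fderiv {n : ℕ} {F : Type*} [NormedAddCommGroup F] [NormedSpace ℝ F]
    {f : E n → F} {x : E n} (hf : ContDiffAt ℝ 2 f x) :
    HasFDerivAt (fderiv ℝ f) (fderiv ℝ (fderiv ℝ f) x) x := by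
  have h1 : ContDiffAt ℝ 1 (fderiv ℝ f) x := hf.fderiv_right (by norm_num)
  exact (h1.differentiableAt (by norm_num)).hasFDerivAt

theorem hasDerivAt_fderiv_line {n : ℕ} {F : Type*} [NormedAddCommGroup F] [NormedSpace ℝ F]
    {f : E n → F} {x : E n} (hf : ContDiffAt ℝ 2 f x) (e : E n) :
    HasDerivAt (fun t : ℝ => fderiv ℝ f (x + t • e) e) (fderiv ℝ (fderiv ℝ f) x e e) 0 := by
  have := (hasDerivAt_comp_line (hasFDerivAt_fderiv hf) e).clm_apply
    (hasDerivAt_const (0 : ℝ) e)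
  simpa using this

theorem snd_fderiv_le_of_isLocalMax {n : ℕ} {g : E n → ℝ} {x : E n} {β : ℝ}
    (hg : ContDiffAt ℝ 2 g x) (h : IsLocalMax (fun y => g y - β / 2 * ‖y‖ ^ 2) x) (e : E n) :
    fderiv ℝ (fderiv ℝ g) x e e ≤ β * ‖e‖ ^ 2 := by
  have h1 : ∀ᶠ t : ℝ in 𝓝 0, HasDerivAt (fun t : ℝ => g (x + t • e) - β / 2 * ‖x + t • e‖ ^ 2)
      (fderiv ℝ g (x + t • e) e - β * ⟪x + t • e, e⟫) t := by
    filter_upwards [(tendsto_line x e).eventually (eventually_hasFDerivAt hg)] with t ht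
    have h3 := (hasDerivAt_comp_line' ht).sub
      (((hasDerivAt_line x e t).norm_sq).const_mul (β / 2))
    refine h3.congr_deriv ?_
    ring
  have h2 : HasDerivAt (fun t : ℝ => fderiv ℝ g (x + t • e) e - β * ⟪x + t • e, e⟫)
      (fderiv ℝ (fderiv ℝ g) x e e - β * ‖e‖ ^ 2) 0 := by
    have h3 := ((hasDerivAt_line x e 0).inner ℝ (hasDerivAt_const (0 : ℝ) e)).const_mul β
    refine ((hasDerivAt_fderiv_line hg e).sub h3).congr_deriv ?_
    simp
  have := second_deriv_nonpos h1 h2 (isLocalMax_comp_line h e)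
  linarith

/-- The second derivative of |W|² also contains 2|DW e|², which has the favourable sign and is
dropped; no bound on DW is required. -/
theorem inner_snd_fderiv_le_of_isLocalMax {n : ℕ} {W : E n → E n} {x : E n} {K : ℝ}
    (hW : ContDiffAt ℝ 2 W x) (h : IsLocalMax (fun y => ‖W y‖ ^ 2 + K / 2 * ‖y‖ ^ 2) x) (e : E n) :
    2 * ⟪W x, fderiv ℝ (fderiv ℝ W) x e e⟫ + K * ‖e‖ ^ 2 ≤ 0 := by
  have h1 : ∀ᶠ t : ℝ in 𝓝 0,
      HasDerivAt (fun t : ℝ => ‖W (x + t • e)‖ ^ 2 + K / 2 * ‖x + t • e‖ ^ 2)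
        (2 * ⟪W (x + t • e), fderiv ℝ W (x + t • e) e⟫ + K * ⟪x + t • e, e⟫) t := by
    filter_upwards [(tendsto_line x e).eventually (eventually_hasFDerivAt hW)] with t ht
    have h3 := ((hasDerivAt_comp_line' ht).norm_sq).add
      (((hasDerivAt_line x e t).norm_sq).const_mul (K / 2))
    refine h3.congr_deriv ?_
    ring
  have hW1 : HasFDerivAt W (fderiv ℝ W x) x := (eventually_hasFDerivAt hW).self_of_nhds
  have h2 : HasDerivAt
      (fun t : ℝ => 2 * ⟪W (x + t • e), fderiv ℝ W (x + t • e) e⟫ + K * ⟪x + t • e, e⟫)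
      (2 * (⟪W x, fderiv ℝ (fderiv ℝ W) x e e⟫ + ‖fderiv ℝ W x e‖ ^ 2) + K * ‖e‖ ^ 2) 0 := by
    have h3 := ((hasDerivAt_line x e 0).inner ℝ (hasDerivAt_const (0 : ℝ) e)).const_mul K
    have h4 := ((hasDerivAt_comp_line hW1 e).inner ℝ (hasDerivAt_fderiv_line hW e)).const_mul 2
    refine (h4.add h3).congr_deriv ?_
    simp
  have := second_deriv_nonpos h1 h2 (isLocalMax_comp_line h e)
  nlinarith [sq_nonneg ‖fderiv ℝ W x e‖]

theorem snd_fderiv_smul {n : ℕ} {b : E n → ℝ} {N : E n → E n} {x : E n}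
    (hb : ContDiffAt ℝ 2 b x) (hN : ContDiffAt ℝ 2 N x) (e : E n) :
    fderiv ℝ (fderiv ℝ fun y => b y • N y) x e e
      = fderiv ℝ (fderiv ℝ b) x e e • N x + (2 * fderiv ℝ b x e) • fderiv ℝ N x e
        + b x • fderiv ℝ (fderiv ℝ N) x e e := by
  have h1 := hasDerivAt_fderiv_line (hb.smul hN) e
  have hb1 := (eventually_hasFDerivAt hb).self_of_nhds
  have hN1 := (eventually_hasFDerivAt hN).self_of_nhds
  have h2 := ((hasDerivAt_comp_line hb1 e).smul (hasDerivAt_fderiv_line hN e)).add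
    ((hasDerivAt_fderiv_line hb e).smul (hasDerivAt_comp_line hN1 e))
  have hev : (fun t : ℝ => fderiv ℝ (fun y => b y • N y) (x + t • e) e) =ᶠ[𝓝 0]
      fun t => b (x + t • e) • fderiv ℝ N (x + t • e) e
        + fderiv ℝ b (x + t • e) e • N (x + t • e) := by
    filter_upwards [(tendsto_line x e).eventually (eventually_hasFDerivAt hb),
      (tendsto_line x e).eventually (eventually_hasFDerivAt hN)] with t htb htN
    rw [(htb.fun_smul htN).fderiv]
    simp
  have := h1.unique (h2.congr_of_eventuallyEq hev)
  refine this.trans ?_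
  simp only [zero_smul, add_zero]
  module

theorem third_fderiv_symm {n : ℕ} {u : E n → ℝ} {x : E n} (hu : ContDiffAt ℝ 3 u x) (e v : E n) :
    fderiv ℝ (fderiv ℝ (fderiv ℝ u)) x e e v = fderiv ℝ (fderiv ℝ (fderiv ℝ u)) x v e e := by
  have h2 : ContDiffAt ℝ 2 (fderiv ℝ u) x := hu.fderiv_right (by norm_num)
  have hs := h2.isSymmSndFDerivAt (by simp) e v
  have hd := hasDerivAt_comp_line (hasFDerivAt_fderiv h2) e
  have h3 := (hd.clm_apply (hasDerivAt_const (0 : ℝ) e)).clm_apply (hasDerivAt_const (0 : ℝ) v)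
  have h4 := (hd.clm_apply (hasDerivAt_const (0 : ℝ) v)).clm_apply (hasDerivAt_const (0 : ℝ) e)
  have hev : (fun t : ℝ => fderiv ℝ (fderiv ℝ u) (x + t • e) e v) =ᶠ[𝓝 0]
      fun t => fderiv ℝ (fderiv ℝ u) (x + t • e) v e := by
    filter_upwards [(tendsto_line x e).eventually (hu.eventually (by simp))] with t ht
    exact ht.isSymmSndFDerivAt minSmoothness_two_le_three e v
  have h5 := h3.unique (h4.congr_of_eventuallyEq hev)
  simp only [map_zero, add_zero] at h5
  rw [h5, hs]

/-! ### The gradient as a vector -/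

/-- The Riesz representative of a continuous linear functional. -/
def riesz (n : ℕ) : (E n →L[ℝ] ℝ) →L[ℝ] E n :=
  LinearMap.toContinuousLinearMap
    { toFun := fun l => (InnerProductSpace.toDual ℝ (E n)).symm l
      map_add' := by simp
      map_smul' := by simp }

theorem inner_riesz {n : ℕ} (l : E n →L[ℝ] ℝ) (v : E n) : ⟪riesz n l, v⟫ = l v :=
  InnerProductSpace.toDual_symm_apply

theorem norm_riesz {n : ℕ} (l : E n →L[ℝ] ℝ) : ‖riesz n l‖ = ‖l‖ :=
  (InnerProductSpace.toDual ℝ (E n)).symm.norm_map l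

theorem inner_snd_fderiv_riesz {n : ℕ} {u : E n → ℝ} {x : E n} (hu : ContDiffAt ℝ 3 u x)
    (e v : E n) : ⟪v, fderiv ℝ (fderiv ℝ fun y => riesz n (fderiv ℝ u y)) x e e⟫
      = fderiv ℝ (fderiv ℝ (fderiv ℝ u)) x v e e := by
  have h2 : ContDiffAt ℝ 2 (fderiv ℝ u) x := hu.fderiv_right (by norm_num)
  have h1 : ContDiffAt ℝ 2 (fun y => riesz n (fderiv ℝ u y)) x :=
    (riesz n).contDiff.contDiffAt.comp x h2
  have hd1 := hasDerivAt_fderiv_line h1 e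
  have hd2 := (riesz n).hasFDerivAt.comp_hasDerivAt (0 : ℝ) (hasDerivAt_fderiv_line h2 e)
  have hev : (fun t : ℝ => fderiv ℝ (fun y => riesz n (fderiv ℝ u y)) (x + t • e) e) =ᶠ[𝓝 0]
      (riesz n) ∘ fun t => fderiv ℝ (fderiv ℝ u) (x + t • e) e := by
    filter_upwards [(tendsto_line x e).eventually (eventually_hasFDerivAt h2)] with t ht
    exact congrArg (fun L => L e) ((riesz n).hasFDerivAt.comp (x + t • e) ht).fderiv
  rw [hd1.unique (hd2.congr_of_eventuallyEq hev), real_inner_comm, inner_riesz,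
    third_fderiv_symm hu]

/-- At an interior maximum of `|Du - bN|² + K|x|²/2`, `b = Φ - εu`, the constant `K` is not too
large. -/
theorem le_of_isLocalMax {n : ℕ} {u Φ : E n → ℝ} {N : E n → E n} {x : E n}
    (hu : ContDiffAt ℝ 3 u x) (hΦ : ContDiffAt ℝ 2 Φ x) (hN : ContDiffAt ℝ 2 N x)
    {ε K C B M b₀ c : ℝ} (hε : 0 ≤ ε)
    (hmax : IsLocalMax (fun y => ‖riesz n (fderiv ℝ u y) - (Φ y - ε * u y) • N y‖ ^ 2
      + K / 2 * ‖y‖ ^ 2) x)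
    {e : OrthonormalBasis (Fin n) ℝ (E n)} {w : Fin n → ℝ} (hw0 : ∀ i, 0 ≤ w i)
    (hw1 : ∑ i, w i = 1)
    (hw2 : |∑ i, w i * fderiv ℝ (fderiv ℝ u) x (e i) (e i)| ≤ C)
    (hw3 : ∀ ξ, |∑ i, w i * fderiv ℝ (fderiv ℝ (fderiv ℝ u)) x ξ (e i) (e i)| ≤ C * ‖ξ‖)
    (hΦ1 : ‖fderiv ℝ Φ x‖ ≤ B) (hΦ2 : ‖fderiv ℝ (fderiv ℝ Φ) x‖ ≤ B)
    (hM : ‖fderiv ℝ u x‖ ≤ M) (hb₀ : |Φ x - ε * u x| ≤ b₀)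
    (hc0 : ‖N x‖ ≤ c) (hc1 : ‖fderiv ℝ N x‖ ≤ c) (hc2 : ‖fderiv ℝ (fderiv ℝ N) x‖ ≤ c) :
    K ≤ 2 * (M + b₀ * c) * (C + (B + ε * C) * c + 2 * (B + ε * M) * c + b₀ * c) := by
  set b : E n → ℝ := fun y => Φ y - ε * u y with hbdef
  set W : E n → E n := fun y => riesz n (fderiv ℝ u y) - b y • N y with hWdef
  have hu2 : ContDiffAt ℝ 2 u x := hu.of_le (by norm_num)
  have hDu : ContDiffAt ℝ 2 (fun y => riesz n (fderiv ℝ u y)) x :=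
    (riesz n).contDiff.contDiffAt.comp x (hu.fderiv_right (by norm_num))
  have hb : ContDiffAt ℝ 2 b x := hΦ.sub (contDiffAt_const.mul hu2)
  have hbN : ContDiffAt ℝ 2 (fun y => b y • N y) x := hb.smul hN
  have hW : ContDiffAt ℝ 2 W x := hDu.sub hbN
  have hc : 0 ≤ c := (norm_nonneg _).trans hc0
  have hB : 0 ≤ B := (norm_nonneg _).trans hΦ1
  have hC : 0 ≤ C := (abs_nonneg _).trans hw2
  have hM0 : 0 ≤ M := (norm_nonneg _).trans hM
  have hb00 : 0 ≤ b₀ := (abs_nonneg _).trans hb₀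
  have hDb : ∀ v, fderiv ℝ b x v = fderiv ℝ Φ x v - ε * fderiv ℝ u x v := by
    intro v
    have := ((eventually_hasFDerivAt hΦ).self_of_nhds.sub
      ((eventually_hasFDerivAt hu2).self_of_nhds.const_mul ε)).fderiv
    rw [show fderiv ℝ b x = _ from this]
    simp
  have hD2b : ∀ v, fderiv ℝ (fderiv ℝ b) x v v
      = fderiv ℝ (fderiv ℝ Φ) x v v - ε * fderiv ℝ (fderiv ℝ u) x v v := by
    intro v
    have hev : fderiv ℝ b =ᶠ[𝓝 x] fun y => fderiv ℝ Φ y - ε • fderiv ℝ u y := by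
      filter_upwards [eventually_hasFDerivAt hΦ, eventually_hasFDerivAt hu2] with y h1 h2
      exact (h1.sub (h2.const_mul ε)).fderiv
    rw [hev.fderiv_eq, ((hasFDerivAt_fderiv hΦ).fun_sub
      ((hasFDerivAt_fderiv hu2).fun_const_smul ε)).fderiv]
    simp
  have hD2W : ∀ v, fderiv ℝ (fderiv ℝ W) x v v
      = fderiv ℝ (fderiv ℝ fun y => riesz n (fderiv ℝ u y)) x v v
        - fderiv ℝ (fderiv ℝ fun y => b y • N y) x v v := by
    intro v
    have hev : fderiv ℝ W =ᶠ[𝓝 x] fun y => fderiv ℝ (fun y => riesz n (fderiv ℝ u y)) y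
        - fderiv ℝ (fun y => b y • N y) y := by
      filter_upwards [eventually_hasFDerivAt hDu, eventually_hasFDerivAt hbN] with y h1 h2
      exact (h1.sub h2).fderiv
    rw [hev.fderiv_eq, ((hasFDerivAt_fderiv hDu).fun_sub (hasFDerivAt_fderiv hbN)).fderiv]
    simp
  have hWx : ‖W x‖ ≤ M + b₀ * c := by
    refine (norm_sub_le _ _).trans (add_le_add ?_ ?_)
    · rw [norm_riesz]; exact hM
    · rw [norm_smul, Real.norm_eq_abs]
      exact mul_le_mul hb₀ hc0 (norm_nonneg _) hb00
  -- The term -εD²u of D²b stays on the left, since D²u is controlled only after averaging with the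
  -- weights `w`.
  have hstep : ∀ i, 2 * (fderiv ℝ (fderiv ℝ (fderiv ℝ u)) x (W x) (e i) (e i)
      + ε * ⟪W x, N x⟫ * fderiv ℝ (fderiv ℝ u) x (e i) (e i)) + K
      ≤ 2 * ‖W x‖ * (B * c + 2 * (B + ε * M) * c + b₀ * c) := by
    intro i
    have he : ‖e i‖ = 1 := e.orthonormal.1 i
    have h1 := inner_snd_fderiv_le_of_isLocalMax hW hmax (e i)
    rw [hD2W, inner_sub_right, inner_snd_fderiv_riesz hu, snd_fderiv_smul hb hN, inner_add_right,
      inner_add_right, inner_smul_right, inner_smul_right, inner_smul_right, hD2b, he] at h1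
    have hbi : ∀ v : E n, ∀ r : ℝ, ‖v‖ ≤ r → |⟪W x, v⟫| ≤ ‖W x‖ * r := fun v r hv =>
      (abs_real_inner_le_norm _ _).trans (mul_le_mul_of_nonneg_left hv (norm_nonneg _))
    have t1 : |fderiv ℝ (fderiv ℝ Φ) x (e i) (e i) * ⟪W x, N x⟫| ≤ B * (‖W x‖ * c) := by
      rw [abs_mul]
      refine mul_le_mul ?_ (hbi _ _ hc0) (abs_nonneg _) hB
      have := (fderiv ℝ (fderiv ℝ Φ) x).le_opNorm₂ (e i) (e i)
      rw [he, mul_one, mul_one] at this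
      exact this.trans hΦ2
    have t2 : |2 * fderiv ℝ b x (e i) * ⟪W x, fderiv ℝ N x (e i)⟫|
        ≤ 2 * (B + ε * M) * (‖W x‖ * c) := by
      rw [abs_mul, abs_mul, abs_two]
      refine mul_le_mul ?_ (hbi _ _ ?_) (abs_nonneg _) (by positivity)
      · refine mul_le_mul_of_nonneg_left ?_ (by norm_num)
        rw [hDb]
        refine (abs_sub _ _).trans (add_le_add ?_ ?_)
        · have := (fderiv ℝ Φ x).le_opNorm (e i)
          rw [he, mul_one] at this
          exact this.trans hΦ1
        · rw [abs_mul, abs_of_nonneg hε]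
          have := (fderiv ℝ u x).le_opNorm (e i)
          rw [he, mul_one] at this
          exact mul_le_mul_of_nonneg_left (this.trans hM) hε
      · have := (fderiv ℝ N x).le_opNorm (e i)
        rw [he, mul_one] at this
        exact this.trans hc1
    have t3 : |b x * ⟪W x, fderiv ℝ (fderiv ℝ N) x (e i) (e i)⟫| ≤ b₀ * (‖W x‖ * c) := by
      rw [abs_mul]
      refine mul_le_mul hb₀ (hbi _ _ ?_) (abs_nonneg _) hb00
      have := (fderiv ℝ (fderiv ℝ N) x).le_opNorm₂ (e i) (e i)
      rw [he, mul_one, mul_one] at this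
      exact this.trans hc2
    have u1 := (abs_le.1 t1).2
    have u2 := (abs_le.1 t2).2
    have u3 := (abs_le.1 t3).2
    linarith
  have hsum := Finset.sum_le_sum fun i (_ : i ∈ Finset.univ) =>
    mul_le_mul_of_nonneg_left (hstep i) (hw0 i)
  rw [← Finset.sum_mul, hw1, one_mul] at hsum
  have hlhs : ∑ i, w i * (2 * (fderiv ℝ (fderiv ℝ (fderiv ℝ u)) x (W x) (e i) (e i)
      + ε * ⟪W x, N x⟫ * fderiv ℝ (fderiv ℝ u) x (e i) (e i)) + K)
      = 2 * (∑ i, w i * fderiv ℝ (fderiv ℝ (fderiv ℝ u)) x (W x) (e i) (e i))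
        + 2 * ε * ⟪W x, N x⟫ * (∑ i, w i * fderiv ℝ (fderiv ℝ u) x (e i) (e i)) + K := by
    have hK : K = ∑ i, w i * K := by rw [← Finset.sum_mul, hw1, one_mul]
    conv_rhs => rw [hK]
    rw [Finset.mul_sum, Finset.mul_sum, ← Finset.sum_add_distrib, ← Finset.sum_add_distrib]
    exact Finset.sum_congr rfl fun i _ => by ring
  rw [hlhs] at hsum
  have h3 := (abs_le.1 (hw3 (W x))).1
  have h2 : |⟪W x, N x⟫ * ∑ i, w i * fderiv ℝ (fderiv ℝ u) x (e i) (e i)| ≤ ‖W x‖ * c * C := by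
    rw [abs_mul]
    refine mul_le_mul ?_ hw2 (abs_nonneg _) (by positivity)
    exact (abs_real_inner_le_norm _ _).trans (mul_le_mul_of_nonneg_left hc0 (norm_nonneg _))
  have h2' := mul_le_mul_of_nonneg_left (abs_le.1 h2).1 hε
  have hfin : K ≤ 2 * ‖W x‖ * (C + (B + ε * C) * c + 2 * (B + ε * M) * c + b₀ * c) := by
    linarith
  refine hfin.trans ?_
  gcongr

/-! ### The outer normal -/

section Geometry

variable {n : ℕ} {Ω : Set (E n)}

theorem gradient_eq_riesz (ρ : E n → ℝ) (x : E n) : gradient ρ x = riesz n (fderiv ℝ ρ x) := rfl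

theorem IsLocalDefiningFunction.tendsto_div {p : E n} {ρ : E n → ℝ}
    (h : IsLocalDefiningFunction 1 Ω p ρ) (v : E n) :
    Filter.Tendsto (fun t : ℝ => t⁻¹ • ρ (p + t • v)) (𝓝[>] 0) (𝓝 ⟪gradient ρ p, v⟫) := by
  have hd : HasFDerivAt ρ (fderiv ℝ ρ p) p :=
    (h.contDiffAt.differentiableAt (by simp)).hasFDerivAt
  have := (hasDerivAt_comp_line hd v).tendsto_slope_zero_right
  rw [gradient_eq_riesz, inner_riesz]
  simpa [h.apply_eq_zero] using this

theorem eventually_line_of_nhds {p : E n} {P : E n → Prop} (h : ∀ᶠ x in 𝓝 p, P x) (v : E n) :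
    ∀ᶠ t : ℝ in 𝓝[>] 0, P (p + t • v) :=
  ((tendsto_line p v).eventually h).filter_mono nhdsWithin_le_nhds

theorem IsLocalDefiningFunction.eventually_mem {p : E n} {ρ : E n → ℝ}
    (h : IsLocalDefiningFunction 1 Ω p ρ) {v : E n} (hv : ⟪gradient ρ p, v⟫ < 0) :
    ∀ᶠ t : ℝ in 𝓝[>] 0, p + t • v ∈ Ω := by
  filter_upwards [(h.tendsto_div v).eventually (gt_mem_nhds hv),
    eventually_line_of_nhds h.mem_iff v, self_mem_nhdsWithin] with t h1 h2 h3
  have ht : 0 < t := h3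
  rw [h2]
  have h1' : t⁻¹ * ρ (p + t • v) < 0 := h1
  by_contra! hcon
  exact absurd h1' (not_lt.2 (by positivity))

theorem IsLocalDefiningFunction.eventually_notMem {p : E n} {ρ : E n → ℝ}
    (h : IsLocalDefiningFunction 1 Ω p ρ) {v : E n} (hv : 0 < ⟪gradient ρ p, v⟫) :
    ∀ᶠ t : ℝ in 𝓝[>] 0, p + t • v ∉ Ω := by
  filter_upwards [(h.tendsto_div v).eventually (lt_mem_nhds hv),
    eventually_line_of_nhds h.mem_iff v, self_mem_nhdsWithin] with t h1 h2 h3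
  have ht : 0 < t := h3
  rw [h2, not_lt]
  have h1' : 0 < t⁻¹ * ρ (p + t • v) := h1
  exact (pos_of_mul_pos_right h1' (by positivity)).le

theorem IsOuterUnitNormal.norm_eq_one {p ν : E n} (h : IsOuterUnitNormal Ω p ν) : ‖ν‖ = 1 := by
  obtain ⟨ρ, hρ, rfl⟩ := h
  have := norm_pos_iff.2 hρ.gradient_ne_zero
  rw [norm_smul, norm_inv, norm_norm, inv_mul_cancel₀ this.ne']

theorem IsOuterUnitNormal.eventually_mem {p ν : E n} (h : IsOuterUnitNormal Ω p ν) {v : E n}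
    (hv : ⟪ν, v⟫ < 0) : ∀ᶠ t : ℝ in 𝓝[>] 0, p + t • v ∈ Ω := by
  obtain ⟨ρ, hρ, rfl⟩ := h
  have := norm_pos_iff.2 hρ.gradient_ne_zero
  refine hρ.eventually_mem ?_
  rw [real_inner_smul_left] at hv
  by_contra! hcon
  exact absurd hv (not_lt.2 (by positivity))

theorem IsOuterUnitNormal.eventually_notMem {p ν : E n} (h : IsOuterUnitNormal Ω p ν) {v : E n}
    (hv : 0 < ⟪ν, v⟫) : ∀ᶠ t : ℝ in 𝓝[>] 0, p + t • v ∉ Ω := by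
  obtain ⟨ρ, hρ, rfl⟩ := h
  refine hρ.eventually_notMem ?_
  rw [real_inner_smul_left] at hv
  exact pos_of_mul_pos_right hv (by positivity)

/-- If the two normals differed, ν' - ν would point strictly inward according to ν and strictly
outward according to ν'. -/
theorem IsOuterUnitNormal.unique {p ν ν' : E n} (h : IsOuterUnitNormal Ω p ν)
    (h' : IsOuterUnitNormal Ω p ν') : ν = ν' := by
  by_contra hne
  have h1 : ⟪ν, ν'⟫ < 1 := (inner_lt_one_iff_real_of_norm_eq_one h.norm_eq_one h'.norm_eq_one).2 hne
  have ha : ⟪ν, ν' - ν⟫ < 0 := by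
    rw [inner_sub_right, real_inner_self_eq_norm_sq, h.norm_eq_one]; linarith
  have hb : 0 < ⟪ν', ν' - ν⟫ := by
    rw [inner_sub_right, real_inner_self_eq_norm_sq, h'.norm_eq_one, real_inner_comm]; linarith
  obtain ⟨t, ht1, ht2⟩ := ((h.eventually_mem ha).and (h'.eventually_notMem hb)).exists
  exact ht2 ht1

theorem IsLocalDefiningFunction.of_le {m m' : ℕ} (hm : m' ≤ m) {p : E n} {ρ : E n → ℝ}
    (h : IsLocalDefiningFunction m Ω p ρ) : IsLocalDefiningFunction m' Ω p ρ :=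
  ⟨h.contDiffAt.of_le (by exact_mod_cast hm), h.apply_eq_zero, h.gradient_ne_zero, h.mem_iff⟩

theorem IsLocalDefiningFunction.eventually {m : ℕ} (hm : 1 ≤ m) (hΩ : IsOpen Ω) {p : E n}
    {ρ : E n → ℝ} (h : IsLocalDefiningFunction m Ω p ρ) :
    ∀ᶠ q in 𝓝 p, ContDiffAt ℝ m ρ q ∧ gradient ρ q ≠ 0 ∧
      (q ∈ frontier Ω → IsLocalDefiningFunction m Ω q ρ) := by
  have hgrad : ContinuousAt (gradient ρ) p := by
    have : ContDiffAt ℝ 0 (fderiv ℝ ρ) p := h.contDiffAt.fderiv_right (by exact_mod_cast hm)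
    exact (riesz n).continuous.continuousAt.comp this.continuousAt
  filter_upwards [h.contDiffAt.eventually (by simp), hgrad.eventually_ne h.gradient_ne_zero,
    h.mem_iff.eventually_nhds] with q hq1 hq2 hq3
  refine ⟨hq1, hq2, fun hq => ⟨hq1, ?_, hq2, hq3⟩⟩
  apply le_antisymm
  · have hfr : ∃ᶠ x in 𝓝 q, x ∈ Ω := mem_closure_iff_frequently.1 hq.1
    have hfr' : ∃ᶠ x in 𝓝 q, ρ x < 0 :=
      (hfr.and_eventually hq3).mono fun x hx => hx.2.1 hx.1
    by_contra! hcon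
    have := hq1.continuousAt.eventually (lt_mem_nhds hcon)
    obtain ⟨x, hx1, hx2⟩ := (hfr'.and_eventually this).exists
    exact lt_asymm hx1 hx2
  · have : q ∉ Ω := fun hqΩ => hq.2 (hΩ.interior_eq.symm ▸ hqΩ)
    rw [hq3.self_of_nhds] at this
    exact not_lt.1 this

/-- The outer normal of a `C³` domain extends to a global `C²` vector field. -/
theorem exists_normal_field (hΩ : IsStrictlyConvexDomain 3 Ω) :
    ∃ N : E n → E n, ContDiff ℝ 2 N ∧ ∀ p ∈ frontier Ω, IsOuterUnitNormal Ω p (N p) := by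
  -- Local fields ∇ρ/|∇ρ| are glued by a partition of unity: the admissible values form a convex
  -- set, at most one point on ∂Ω and the whole space elsewhere.
  obtain ⟨g, hg⟩ := exists_contMDiffMap_forall_mem_convex_of_local
    (modelWithCornersSelf ℝ (E n)) (n := 2)
    (t := fun x : E n => {ν : E n | x ∈ frontier Ω → IsOuterUnitNormal Ω x ν})
    (by
      intro x
      by_cases hx : x ∈ frontier Ω
      · refine Set.Subsingleton.convex fun ν hν ν' hν' => (hν hx).unique (hν' hx)
      · rw [show {ν : E n | x ∈ frontier Ω → IsOuterUnitNormal Ω x ν} = Set.univ by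
          ext ν; simp [hx]]
        exact convex_univ)
    (by
      intro x
      by_cases hx : x ∈ frontier Ω
      · obtain ⟨ρ, hρ, -⟩ := hΩ.boundary x hx
        have hev := hρ.eventually (by norm_num) hΩ.isOpen
        refine ⟨_, hev, fun y => ‖gradient ρ y‖⁻¹ • gradient ρ y, ?_, ?_⟩
        · rw [contMDiffOn_iff_contDiffOn]
          intro y hy
          have hgr : ContDiffAt ℝ 2 (gradient ρ) y :=
            (riesz n).contDiff.contDiffAt.comp y (hy.1.fderiv_right (by norm_num))
          exact (((hgr.norm ℝ hy.2.1).inv (norm_ne_zero_iff.2 hy.2.1)).smul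
            hgr).contDiffWithinAt
        · exact fun y hy hyf => ⟨ρ, (hy.2.2 hyf).of_le (by norm_num), rfl⟩
      · exact ⟨(frontier Ω)ᶜ, isClosed_frontier.isOpen_compl.mem_nhds hx, fun _ => 0,
          contMDiffOn_const, fun y hy hy' => absurd hy' hy⟩)
  exact ⟨g, g.contMDiff.contDiff, hg⟩

/-! ### Tangential derivatives -/

theorem exists_mem_frontier_of_segment {x y : E n} (hx : x ∈ Ω) (hy : y ∉ Ω) :
    ∃ z ∈ segment ℝ x y, z ∈ frontier Ω := by
  by_contra! hcon
  have hpre : IsPreconnected (segment ℝ x y) := (convex_segment x y).isPreconnected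
  have hcov : segment ℝ x y ⊆ interior Ω ∪ (closure Ω)ᶜ := by
    intro z hz
    by_contra hz'
    rw [Set.mem_union, not_or, Set.mem_compl_iff, not_not] at hz'
    exact hcon z hz ⟨hz'.2, hz'.1⟩
  have hxi : x ∈ interior Ω := by
    rcases hcov (left_mem_segment ℝ x y) with h | h
    · exact h
    · exact absurd (subset_closure hx) h
  have hyi : y ∈ (closure Ω)ᶜ := by
    rcases hcov (right_mem_segment ℝ x y) with h | h
    · exact absurd (interior_subset h) hy
    · exact h
  obtain ⟨z, -, hz1, hz2⟩ := hpre _ _ isOpen_interior isClosed_closure.isOpen_compl hcov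
    ⟨x, left_mem_segment ℝ x y, hxi⟩ ⟨y, right_mem_segment ℝ x y, hyi⟩
  exact hz2 (subset_closure (interior_subset hz1))

/-- For small t, p + t(τ - δν) lies in Ω and p + t(τ + δν) does not, so the segment between them
meets ∂Ω; then δ → 0. -/
theorem IsOuterUnitNormal.mem_tangentConeAt {p ν : E n} (h : IsOuterUnitNormal Ω p ν) {τ : E n}
    (hτ : ⟪ν, τ⟫ = 0) : τ ∈ tangentConeAt ℝ (frontier Ω) p := by
  have key : ∀ m : ℕ, ∃ t s : ℝ, 0 < t ∧ t < 1 / ((m : ℝ) + 1) ∧ |s| ≤ 1 / ((m : ℝ) + 1) ∧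
      p + t • (τ + s • ν) ∈ frontier Ω := by
    intro m
    set δ : ℝ := 1 / ((m : ℝ) + 1) with hδdef
    have hδ : 0 < δ := by positivity
    have hi : ∀ s : ℝ, ⟪ν, τ + s • ν⟫ = s := by
      intro s
      rw [inner_add_right, real_inner_smul_right, hτ, real_inner_self_eq_norm_sq, h.norm_eq_one]
      ring
    have h1 := h.eventually_mem (v := τ + (-δ) • ν) (by rw [hi]; linarith)
    have h2 := h.eventually_notMem (v := τ + δ • ν) (by rw [hi]; exact hδ)
    have h3 : ∀ᶠ t : ℝ in 𝓝[>] 0, t < δ :=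
      (gt_mem_nhds hδ : ∀ᶠ t : ℝ in 𝓝 0, t < δ).filter_mono nhdsWithin_le_nhds
    obtain ⟨t, ⟨⟨ht1, ht2⟩, ht3⟩, ht4⟩ :=
      (((h1.and h2).and h3).and self_mem_nhdsWithin).exists
    obtain ⟨z, ⟨a, b, ha, hb, hab, rfl⟩, hz⟩ := exists_mem_frontier_of_segment ht1 ht2
    refine ⟨t, (b - a) * δ, ht4, ht3, ?_, ?_⟩
    · rw [abs_mul, abs_of_pos hδ]
      have : |b - a| ≤ 1 := abs_le.2 ⟨by linarith, by linarith⟩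
      nlinarith
    · convert hz using 1
      have ha' : a = 1 - b := by linarith
      rw [ha']
      module
  choose t s ht0 ht1 hs hmem using key
  have hlim : Filter.Tendsto (fun m : ℕ => 1 / ((m : ℝ) + 1)) Filter.atTop (𝓝 0) :=
    tendsto_one_div_add_atTop_nhds_zero_nat
  have htl : Filter.Tendsto t Filter.atTop (𝓝 0) :=
    squeeze_zero (fun m => (ht0 m).le) (fun m => (ht1 m).le) hlim
  have hsl : Filter.Tendsto s Filter.atTop (𝓝 0) := squeeze_zero_norm hs hlim
  have hvl : Filter.Tendsto (fun m => τ + s m • ν) Filter.atTop (𝓝 τ) := by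
    simpa using tendsto_const_nhds.add (hsl.smul_const ν)
  refine mem_tangentConeAt_of_seq Filter.atTop (fun m => (t m)⁻¹)
    (fun m => t m • (τ + s m • ν)) ?_ (Filter.Eventually.of_forall hmem) ?_
  · simpa using htl.smul hvl
  · refine hvl.congr fun m => ?_
    rw [smul_smul, inv_mul_cancel₀ (ht0 m).ne', one_smul]

/-- Identities valid on ∂Ω can thus be differentiated tangentially without a parametrization of the
boundary. -/
theorem IsOuterUnitNormal.fderiv_apply_eq_zero {p ν : E n} (h : IsOuterUnitNormal Ω p ν)
    (hp : p ∈ frontier Ω) {τ : E n} (hτ : ⟪ν, τ⟫ = 0) {f : E n → ℝ} {f' : E n →L[ℝ] ℝ}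
    (hf : HasFDerivWithinAt f f' (frontier Ω) p) (h0 : f =ᶠ[𝓝[frontier Ω] p] fun _ => 0) :
    f' τ = 0 := by
  have hc : HasFDerivWithinAt f (0 : E n →L[ℝ] ℝ) (frontier Ω) p :=
    (hasFDerivWithinAt_const (0 : ℝ) p _).congr_of_eventuallyEq h0 (h0.self_of_nhdsWithin hp)
  simpa using hf.unique_on hc (h.mem_tangentConeAt hτ)

/-- Differentiate |∇ρ| N = ∇ρ along τ on ∂Ω and pair with τ; the derivative of |∇ρ| drops out since
N ⊥ τ. -/
theorem inner_fderiv_normal_pos (hΩ : IsStrictlyConvexDomain 3 Ω) {N : E n → E n}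
    (hN : ContDiff ℝ 2 N) (hNν : ∀ p ∈ frontier Ω, IsOuterUnitNormal Ω p (N p)) {p : E n}
    (hp : p ∈ frontier Ω) {τ : E n} (hτ0 : τ ≠ 0) (hτ : ⟪N p, τ⟫ = 0) :
    0 < ⟪fderiv ℝ N p τ, τ⟫ := by
  obtain ⟨ρ, hρ, hconv⟩ := hΩ.boundary p hp
  have hnormal : ∀ q, IsLocalDefiningFunction 3 Ω q ρ → q ∈ frontier Ω →
      ‖gradient ρ q‖ • N q = gradient ρ q := by
    intro q hq hqf
    have := (hNν q hqf).unique ⟨ρ, hq.of_le (by norm_num), rfl⟩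
    rw [this, smul_smul, mul_inv_cancel₀ (norm_ne_zero_iff.2 hq.gradient_ne_zero), one_smul]
  have hval : ∀ q, ⟪gradient ρ q, τ⟫ = fderiv ℝ ρ q τ := fun q => inner_riesz _ _
  have hρτ : fderiv ℝ ρ p τ = 0 := by
    rw [← hval, ← hnormal p hρ hp, real_inner_smul_left, hτ, mul_zero]
  have hpos := hconv τ hτ0 hρτ
  have hρ3 : ContDiffAt ℝ 3 ρ p := hρ.contDiffAt
  have hgr : ContDiffAt ℝ 2 (gradient ρ) p :=
    (riesz n).contDiff.contDiffAt.comp p (hρ3.fderiv_right (by norm_num))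
  have hng : HasFDerivAt (fun y => ‖gradient ρ y‖) (fderiv ℝ (fun y => ‖gradient ρ y‖) p) p :=
    ((hgr.norm ℝ hρ.gradient_ne_zero).differentiableAt (by norm_num)).hasFDerivAt
  have hNd : HasFDerivAt N (fderiv ℝ N p) p :=
    (hN.differentiable (by norm_num) p).hasFDerivAt
  have hρd : HasFDerivAt (fderiv ℝ ρ) (fderiv ℝ (fderiv ℝ ρ) p) p :=
    hasFDerivAt_fderiv (hρ3.of_le (by norm_num))
  have hd := (hρd.clm_apply (hasFDerivAt_const τ p)).sub
    (hng.mul (hNd.inner ℝ (hasFDerivAt_const τ p)))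
  have hz := (hNν p hp).fderiv_apply_eq_zero hp hτ hd.hasFDerivWithinAt (by
    filter_upwards [nhdsWithin_le_nhds (hρ.eventually (by norm_num) hΩ.isOpen),
      self_mem_nhdsWithin] with q hq hqf
    change fderiv ℝ ρ q τ - ‖gradient ρ q‖ * ⟪N q, τ⟫ = 0
    rw [← hval, ← real_inner_smul_left, hnormal q (hq.2.2 hqf) hqf, sub_self])
  simp [hτ] at hz
  have hg : 0 < ‖gradient ρ p‖ := norm_pos_iff.2 hρ.gradient_ne_zero
  have : 0 < ‖gradient ρ p‖ * ⟪fderiv ℝ N p τ, τ⟫ := by linarith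
  exact pos_of_mul_pos_right this hg.le

/-- Compactness of the set of unit tangent vectors to ∂Ω, then homogeneity in τ. -/
theorem exists_curvature_bound (hΩ : IsStrictlyConvexDomain 3 Ω) {N : E n → E n}
    (hN : ContDiff ℝ 2 N) (hNν : ∀ p ∈ frontier Ω, IsOuterUnitNormal Ω p (N p)) :
    ∃ κ : ℝ, 0 < κ ∧ ∀ p ∈ frontier Ω, ∀ τ : E n, ⟪N p, τ⟫ = 0 →
      κ * ‖τ‖ ^ 2 ≤ ⟪fderiv ℝ N p τ, τ⟫ := by
  have hNc : Continuous N := hN.continuous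
  have hN' : Continuous (fderiv ℝ N) := hN.continuous_fderiv (by norm_num)
  have hfc : IsCompact (frontier Ω) :=
    Metric.isCompact_of_isClosed_isBounded isClosed_frontier
      (hΩ.isBounded.closure.subset frontier_subset_closure)
  set S : Set (E n × E n) := (frontier Ω ×ˢ Metric.sphere 0 1) ∩ {z | ⟪N z.1, z.2⟫ = 0} with hS
  have hSc : IsCompact S := by
    refine (hfc.prod (isCompact_sphere 0 1)).inter_right (isClosed_eq ?_ continuous_const)
    fun_prop
  have hF : Continuous fun z : E n × E n => ⟪fderiv ℝ N z.1 z.2, z.2⟫ := by fun_prop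
  obtain ⟨κ, hκ, hmin⟩ : ∃ κ : ℝ, 0 < κ ∧ ∀ z ∈ S, κ ≤ ⟪fderiv ℝ N z.1 z.2, z.2⟫ := by
    rcases S.eq_empty_or_nonempty with hE | hE
    · exact ⟨1, one_pos, by simp [hE]⟩
    · obtain ⟨z, hz, hzm⟩ := hSc.exists_isMinOn hE hF.continuousOn
      refine ⟨_, ?_, fun y hy => hzm hy⟩
      have hz1 : ‖z.2‖ = 1 := by simpa using hz.1.2
      exact inner_fderiv_normal_pos hΩ hN hNν hz.1.1
        (norm_ne_zero_iff.1 (by rw [hz1]; norm_num)) hz.2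
  refine ⟨κ, hκ, fun p hp τ hτ => ?_⟩
  rcases eq_or_ne τ 0 with rfl | hτ0
  · simp
  have hn : 0 < ‖τ‖ := norm_pos_iff.2 hτ0
  have := hmin (p, ‖τ‖⁻¹ • τ) ⟨⟨hp, by simp [norm_smul, hn.ne']⟩, by
    simp [real_inner_smul_right, hτ]⟩
  simp only [map_smul, real_inner_smul_left, real_inner_smul_right] at this
  calc κ * ‖τ‖ ^ 2 ≤ (‖τ‖⁻¹ * (‖τ‖⁻¹ * ⟪fderiv ℝ N p τ, τ⟫)) * ‖τ‖ ^ 2 := by gcongr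
    _ = _ := by field_simp

/-! ### Boundary maxima -/

theorem IsOuterUnitNormal.nonneg_of_isMaxOn {p ν : E n} (h : IsOuterUnitNormal Ω p ν)
    (hconv : Convex ℝ Ω) (hp : p ∈ frontier Ω) {f : E n → ℝ} {f' : E n →L[ℝ] ℝ}
    (hf : HasFDerivWithinAt f f' (closure Ω) p) (hmax : IsMaxOn f (closure Ω) p) :
    0 ≤ f' ν := by
  have hν : ⟪ν, -ν⟫ < 0 := by
    rw [inner_neg_right, real_inner_self_eq_norm_sq, h.norm_eq_one]; norm_num
  obtain ⟨t, ht, ht0⟩ := ((h.eventually_mem hν).and self_mem_nhdsWithin).exists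
  have hseg : segment ℝ p (p + t • (-ν)) ⊆ closure Ω :=
    hconv.closure.segment_subset hp.1 (subset_closure ht)
  have := hmax.localize.hasFDerivWithinAt_nonpos hf (mem_posTangentConeAt_of_segment_subset hseg)
  rw [map_smul, map_neg, smul_eq_mul] at this
  have ht0' : 0 < t := ht0
  nlinarith

theorem boundary_estimate (hΩ : IsStrictlyConvexDomain 3 Ω) {N : E n → E n}
    (hN : ContDiff ℝ 2 N) (hNν : ∀ p ∈ frontier Ω, IsOuterUnitNormal Ω p (N p))
    {u Φ : E n → ℝ} (hu : ContDiffOn ℝ 2 u (closure Ω)) (hΦ : ContDiffOn ℝ 2 Φ (closure Ω))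
    {ε K B b₀ c κ R : ℝ} (hε : 0 ≤ ε) (hK : 0 ≤ K)
    (hbc : ∀ q ∈ frontier Ω, fderivWithin ℝ u (closure Ω) q (N q) = Φ q - ε * u q)
    {p : E n} (hp : p ∈ frontier Ω)
    (hmax : IsMaxOn (fun y => ‖riesz n (fderivWithin ℝ u (closure Ω) y) - (Φ y - ε * u y) • N y‖ ^ 2
      + K / 2 * ‖y‖ ^ 2) (closure Ω) p)
    (hκ : ∀ τ : E n, ⟪N p, τ⟫ = 0 → κ * ‖τ‖ ^ 2 ≤ ⟪fderiv ℝ N p τ, τ⟫)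
    (hB : ‖fderivWithin ℝ Φ (closure Ω) p‖ ≤ B) (hb₀ : |Φ p - ε * u p| ≤ b₀)
    (hc : ‖fderiv ℝ N p‖ ≤ c) (hR : ‖p‖ ≤ R) {τ : E n}
    (hτdef : τ = riesz n (fderivWithin ℝ u (closure Ω) p) - (Φ p - ε * u p) • N p) :
    2 * κ * ‖τ‖ ^ 2 ≤ 2 * (B + 2 * b₀ * c) * ‖τ‖ + K * R := by
  have hpc : p ∈ closure Ω := hp.1
  have hint : (interior (closure Ω)).Nonempty :=
    hΩ.nonempty.mono (interior_maximal subset_closure hΩ.isOpen)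
  have huniq : UniqueDiffOn ℝ (closure Ω) := uniqueDiffOn_convex hΩ.convex.closure hint
  have hν := hNν p hp
  set ν := N p with hνdef
  have hν1 : ‖ν‖ = 1 := hν.norm_eq_one
  set D := fderivWithin ℝ u (closure Ω) with hD
  set H := fderivWithin ℝ D (closure Ω) p with hH
  have hDc : ContDiffOn ℝ 1 D (closure Ω) := hu.fderivWithin huniq (by norm_num)
  have hDd : HasFDerivWithinAt D H (closure Ω) p :=
    ((hDc.differentiableOn (by norm_num)) p hpc).hasFDerivWithinAt
  have hud : HasFDerivWithinAt u (D p) (closure Ω) p :=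
    ((hu.differentiableOn (by norm_num)) p hpc).hasFDerivWithinAt
  have hΦd : HasFDerivWithinAt Φ (fderivWithin ℝ Φ (closure Ω) p) (closure Ω) p :=
    ((hΦ.differentiableOn (by norm_num)) p hpc).hasFDerivWithinAt
  set Φ' := fderivWithin ℝ Φ (closure Ω) p
  have hNd : HasFDerivWithinAt N (fderiv ℝ N p) (closure Ω) p :=
    (hN.differentiable (by norm_num) p).hasFDerivAt.hasFDerivWithinAt
  set N' := fderiv ℝ N p
  have hbd : HasFDerivWithinAt (fun y => Φ y - ε * u y) (Φ' - ε • D p) (closure Ω) p :=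
    hΦd.fun_sub (hud.const_mul ε)
  set b := Φ p - ε * u p with hb
  have hsymm : ∀ v w, H v w = H w v := by
    have hcl : p ∈ closure (interior (closure Ω)) :=
      closure_mono (interior_maximal subset_closure hΩ.isOpen) hpc
    exact fun v w =>
      (hu p hpc).isSymmSndFDerivWithinAt (by simp) huniq hcl hpc v w
  have hτν : ⟪ν, τ⟫ = 0 := by
    rw [hτdef, inner_sub_right, real_inner_smul_right, real_inner_comm, inner_riesz,
      real_inner_self_eq_norm_sq, hν1, hbc p hp]
    ring
  have hDτ : ∀ v, D p v = ⟪τ, v⟫ + b * ⟪ν, v⟫ := by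
    intro v
    rw [hτdef, inner_sub_left, inner_riesz, real_inner_smul_left]
    ring
  have hgd := (hDd.clm_apply hNd).fun_sub hbd
  have htan := hν.fderiv_apply_eq_zero hp hτν (hgd.mono frontier_subset_closure) (by
    filter_upwards [self_mem_nhdsWithin] with q hq
    rw [hbc q hq, sub_self])
  -- The Neumann condition differentiated along τ, with Du = τ + bν inserted.
  have htan' : H τ ν = Φ' τ - ε * ‖τ‖ ^ 2 - ⟪N' τ, τ⟫ - b * ⟪ν, N' τ⟫ := by
    have h1 : D p (N' τ) + H τ ν - (Φ' τ - ε * D p τ) = 0 := by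
      simpa using htan
    rw [hDτ, hDτ, hτν, real_inner_self_eq_norm_sq, real_inner_comm] at h1
    linarith
  have hVd : HasFDerivWithinAt (fun y => riesz n (D y) - (Φ y - ε * u y) • N y)
      ((riesz n).comp H - (b • N' + (Φ' - ε • D p).smulRight ν)) (closure Ω) p :=
    ((riesz n).hasFDerivAt.comp_hasFDerivWithinAt p hDd).fun_sub (hbd.fun_smul hNd)
  have hfd := (hVd.norm_sq).fun_add
    (((hasFDerivWithinAt_id p (closure Ω)).norm_sq).const_mul (K / 2))
  have hnn := hν.nonneg_of_isMaxOn hΩ.convex hp hfd hmax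
  -- The normal derivative of G at its maximum; the normal derivative of b multiplies ⟨τ, ν⟩ = 0 and
  -- disappears.
  have hnn' : 0 ≤ 2 * (H ν τ - b * ⟪τ, N' ν⟫) + K * ⟪p, ν⟫ := by
    have h1 : 0 ≤ 2 * ⟪τ, riesz n (H ν) - (b • N' ν + (Φ' ν - ε * D p ν) • ν)⟫
        + K / 2 * (2 * ⟪p, ν⟫) := by
      refine hnn.trans_eq ?_
      simp [hτdef, hb, hνdef, inner_sub_left, inner_sub_right, inner_add_right,
        real_inner_smul_left, real_inner_smul_right]
      ring
    rw [inner_sub_right, inner_add_right, real_inner_smul_right, real_inner_smul_right,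
      real_inner_comm, inner_riesz, real_inner_comm ν τ, hτν] at h1
    linarith
  -- Symmetry of D²u up to the boundary links the two conditions and brings in the curvature term.
  rw [hsymm ν τ, htan'] at hnn'
  have hb00 : 0 ≤ b₀ := (abs_nonneg _).trans hb₀
  have hN'b : ∀ v, ‖N' v‖ ≤ c * ‖v‖ := fun v => (N'.le_opNorm v).trans (by gcongr)
  have t1 : Φ' τ ≤ B * ‖τ‖ :=
    (le_abs_self _).trans ((Φ'.le_opNorm τ).trans (by gcongr))
  have t2 : -(b * ⟪ν, N' τ⟫) ≤ b₀ * (c * ‖τ‖) := by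
    refine (neg_le_abs _).trans ?_
    rw [abs_mul]
    refine mul_le_mul hb₀ ?_ (abs_nonneg _) hb00
    refine (abs_real_inner_le_norm _ _).trans ?_
    rw [hν1, one_mul]
    exact hN'b τ
  have t3 : -(b * ⟪τ, N' ν⟫) ≤ b₀ * (c * ‖τ‖) := by
    refine (neg_le_abs _).trans ?_
    rw [abs_mul]
    refine mul_le_mul hb₀ ?_ (abs_nonneg _) hb00
    refine (abs_real_inner_le_norm _ _).trans ?_
    have := hN'b ν
    rw [hν1, mul_one] at this
    rw [mul_comm]
    gcongr
  have t4 : K * ⟪p, ν⟫ ≤ K * R := by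
    refine mul_le_mul_of_nonneg_left ?_ hK
    have := real_inner_le_norm p ν
    rw [hν1, mul_one] at this
    exact this.trans hR
  have t5 := hκ τ hτν
  have t6 : 0 ≤ ε * ‖τ‖ ^ 2 := by positivity
  linarith

end Geometry

/-! ### Norms -/

section Norms

variable {n : ℕ} {Ω : Set (E n)}

theorem norm_iteratedFDeriv_le_of_cNorm {m : ℕ} {f : E n → ℝ} {B : ℝ≥0} (h : cNorm m Ω f ≤ B)
    {j : ℕ} (hj : j ≤ m) {x : E n} (hx : x ∈ Ω) : ‖iteratedFDeriv ℝ j f x‖ ≤ B := by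
  have h1 : ‖iteratedFDeriv ℝ j f x‖ₑ ≤ cNorm m Ω f :=
    (le_iSup₂ (f := fun x (_ : x ∈ Ω) => ‖iteratedFDeriv ℝ j f x‖ₑ) x hx).trans
      (Finset.single_le_sum (f := fun j => ⨆ x ∈ Ω, ‖iteratedFDeriv ℝ j f x‖ₑ)
        (fun _ _ => zero_le) (Finset.mem_range.2 (Nat.lt_succ_of_le hj)))
  have h2 := h1.trans h
  rw [enorm_le_coe] at h2
  exact_mod_cast h2

theorem abs_le_of_cNorm {m : ℕ} {f : E n → ℝ} {B : ℝ≥0} (h : cNorm m Ω f ≤ B) {x : E n}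
    (hx : x ∈ Ω) : |f x| ≤ B := by
  simpa using norm_iteratedFDeriv_le_of_cNorm h (Nat.zero_le m) hx

theorem norm_fderiv_le_of_cNorm {m : ℕ} {f : E n → ℝ} {B : ℝ≥0} (h : cNorm m Ω f ≤ B)
    (hm : 1 ≤ m) {x : E n} (hx : x ∈ Ω) : ‖fderiv ℝ f x‖ ≤ B := by
  have := norm_iteratedFDeriv_le_of_cNorm h hm hx
  rwa [norm_iteratedFDeriv_one] at this

theorem norm_snd_fderiv_le_of_cNorm {m : ℕ} {f : E n → ℝ} {B : ℝ≥0} (h : cNorm m Ω f ≤ B)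
    (hm : 2 ≤ m) {x : E n} (hx : x ∈ Ω) : ‖fderiv ℝ (fderiv ℝ f) x‖ ≤ B := by
  have := norm_iteratedFDeriv_le_of_cNorm h hm hx
  rwa [← norm_iteratedFDeriv_fderiv, norm_iteratedFDeriv_one] at this

/-- The infimum need not be attained, which costs the additional 1. -/
theorem exists_extension_of_cBoundaryNorm_le {m : ℕ} {φ : E n → ℝ} {B : ℝ≥0}
    (h : cBoundaryNorm m Ω φ ≤ B) :
    ∃ Φ, IsExtension m Ω φ Φ ∧ cNorm m Ω Φ ≤ ((B + 1 : ℝ≥0) : ℝ≥0∞) := by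
  have hlt : cBoundaryNorm m Ω φ < ((B + 1 : ℝ≥0) : ℝ≥0∞) :=
    h.trans_lt (by exact_mod_cast lt_add_one B)
  obtain ⟨Φ, hΦ⟩ := iInf_lt_iff.1 hlt
  obtain ⟨hext, hΦ⟩ := iInf_lt_iff.1 hΦ
  exact ⟨Φ, hext, hΦ.le⟩

end Norms

/-! ### A priori estimates: εu, the gradient and the oscillation -/

section Estimates

variable {n k : ℕ} {Ω : Set (E n)} {α : Fin k → E n → ℝ} {φ Φ u : E n → ℝ} {N : E n → E n}
  {ε a A B R : ℝ}

theorem IsStrictlyConvexDomain.uniqueDiffOn {m : ℕ} (hΩ : IsStrictlyConvexDomain m Ω) :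
    UniqueDiffOn ℝ (closure Ω) :=
  uniqueDiffOn_convex hΩ.convex.closure
    (hΩ.nonempty.mono (interior_maximal subset_closure hΩ.isOpen))

theorem IsStrictlyConvexDomain.isCompact_closure {m : ℕ} (hΩ : IsStrictlyConvexDomain m Ω) :
    IsCompact (closure Ω) :=
  Metric.isCompact_of_isClosed_isBounded isClosed_closure hΩ.isBounded.closure

theorem closure_mem_nhds_of_mem (hΩ : IsOpen Ω) {x : E n} (hx : x ∈ Ω) : closure Ω ∈ 𝓝 x :=
  Filter.mem_of_superset (hΩ.mem_nhds hx) subset_closure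

theorem mem_or_mem_frontier (hΩ : IsOpen Ω) {x : E n} (hx : x ∈ closure Ω) :
    x ∈ Ω ∨ x ∈ frontier Ω := by
  by_cases h : x ∈ Ω
  · exact Or.inl h
  · exact Or.inr ⟨hx, by rwa [hΩ.interior_eq]⟩

/-- The constant in the bound of `ε|u|`. -/
def supConst (k : ℕ) (A B R : ℝ) : ℝ := B + (k * (1 + k * A) + 1) * (R + R ^ 2)

/-- Since σ_1 > 0, u has no interior maximum; at a boundary maximum u_ν ≥ 0, that is, εu ≤ φ. -/
theorem eps_mul_le (hk : 2 ≤ k) (hkn : k ≤ n) (hΩ : IsStrictlyConvexDomain 3 Ω)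
    (hNν : ∀ p ∈ frontier Ω, IsOuterUnitNormal Ω p (N p))
    (hsol : IsApproxSolution k Ω α φ ε u) (hε : 0 < ε)
    (hφB : ∀ p ∈ frontier Ω, |φ p| ≤ B) {x : E n} (hx : x ∈ closure Ω) : ε * u x ≤ B := by
  obtain ⟨p, hp, hmax⟩ := hΩ.isCompact_closure.exists_isMaxOn ⟨x, hx⟩
    hsol.contDiffOn_closure.continuousOn
  rcases mem_or_mem_frontier hΩ.isOpen hp with hpΩ | hpf
  · exfalso
    have hu3 : ContDiffAt ℝ 3 u p := hsol.contDiffOn.contDiffAt (hΩ.isOpen.mem_nhds hpΩ)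
    obtain ⟨e, lam, -, hd, hpos, -⟩ := exists_eigenbasis hpΩ hu3 hsol.admissible hsol.equation
    have hloc : IsLocalMax (fun y => u y - 0 / 2 * ‖y‖ ^ 2) p := by
      simpa using hmax.isLocalMax (closure_mem_nhds_of_mem hΩ.isOpen hpΩ)
    have hle : ∀ i, lam i ≤ 0 := by
      intro i
      have := snd_fderiv_le_of_isLocalMax (hu3.of_le (by norm_num)) hloc (e i)
      rwa [hd, zero_mul] at this
    have h1 := hpos 1 (by omega)
    have h2 := sum_mul_esymDeriv lam (m := 1) (by omega)
    simp only [esymDeriv, esymErase_zero, mul_one, Nat.cast_one, one_mul] at h2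
    rw [← h2] at h1
    exact absurd (Finset.sum_nonpos fun i _ => hle i) (not_le.2 h1)
  · have hd : HasFDerivWithinAt u (fderivWithin ℝ u (closure Ω) p) (closure Ω) p :=
      ((hsol.contDiffOn_closure.differentiableOn (by norm_num)) p hp).hasFDerivWithinAt
    have h0 := (hNν p hpf).nonneg_of_isMaxOn hΩ.convex hpf hd hmax
    rw [hsol.neumann p hpf _ (hNν p hpf)] at h0
    have h1 := (abs_le.1 (hφB p hpf)).2
    have h2 : u x ≤ u p := hmax hx
    nlinarith

/-- At an interior minimum of u - (β/2)|x|² all eigenvalues of D²u would be at least β, which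
`exists_lt_of_equation` excludes. At a boundary minimum u_ν ≤ β⟨p, ν⟩, and the Neumann condition
bounds εu(p) from below. -/
theorem neg_le_eps_mul (hk : 2 ≤ k) (hkn : k ≤ n) (hΩ : IsStrictlyConvexDomain 3 Ω)
    (hNν : ∀ p ∈ frontier Ω, IsOuterUnitNormal Ω p (N p))
    (hsol : IsApproxSolution k Ω α φ ε u) (hε : 0 < ε) (hε1 : ε ≤ 1)
    (hφB : ∀ p ∈ frontier Ω, |φ p| ≤ B) (hR : ∀ x ∈ closure Ω, ‖x‖ ≤ R)
    (hα0 : ∀ l, ∀ x ∈ Ω, 0 ≤ α l x) (hαA : ∀ l, ∀ x ∈ Ω, α l x ≤ A) (hA : 0 ≤ A)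
    {x : E n} (hx : x ∈ closure Ω) : -supConst k A B R ≤ ε * u x := by
  set β : ℝ := k * (1 + k * A) + 1 with hβdef
  have hβ : 0 < β := by positivity
  have hcont : ContinuousOn (fun y => -u y - -β / 2 * ‖y‖ ^ 2) (closure Ω) :=
    hsol.contDiffOn_closure.continuousOn.neg.sub (by fun_prop)
  obtain ⟨p, hp, hmax⟩ := hΩ.isCompact_closure.exists_isMaxOn ⟨x, hx⟩ hcont
  rcases mem_or_mem_frontier hΩ.isOpen hp with hpΩ | hpf
  · exfalso
    have hu3 : ContDiffAt ℝ 3 u p := hsol.contDiffOn.contDiffAt (hΩ.isOpen.mem_nhds hpΩ)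
    obtain ⟨e, lam, -, hd, hpos, heq⟩ := exists_eigenbasis hpΩ hu3 hsol.admissible hsol.equation
    have hloc := hmax.isLocalMax (closure_mem_nhds_of_mem hΩ.isOpen hpΩ)
    obtain ⟨i, hi⟩ := exists_lt_of_equation hk hkn hpos (fun l => hα0 l p hpΩ)
      (fun l => hαA l p hpΩ) heq (β := β) (by rw [hβdef]; linarith)
    have h1 := snd_fderiv_le_of_isLocalMax (g := fun y => -u y)
      (hu3.of_le (by norm_num)).neg hloc (e i)
    have h2 : fderiv ℝ (fderiv ℝ fun y => -u y) p (e i) (e i) = -lam i := by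
      rw [← hd i]
      have : (fderiv ℝ fun y => -u y) = fun y => -fderiv ℝ u y := by
        funext y; exact fderiv_fun_neg
      rw [this, fderiv_fun_neg]
      simp
    rw [h2, e.orthonormal.1 i] at h1
    linarith
  · have hud : HasFDerivWithinAt u (fderivWithin ℝ u (closure Ω) p) (closure Ω) p :=
      ((hsol.contDiffOn_closure.differentiableOn (by norm_num)) p hp).hasFDerivWithinAt
    have hd := hud.fun_neg.fun_sub
      (((hasFDerivWithinAt_id p (closure Ω)).norm_sq).const_mul (-β / 2))
    have h0 := (hNν p hpf).nonneg_of_isMaxOn hΩ.convex hpf hd hmax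
    have h0' : 0 ≤ -(fderivWithin ℝ u (closure Ω) p (N p)) + β * ⟪p, N p⟫ := by
      refine h0.trans_eq ?_
      simp
      ring
    rw [hsol.neumann p hpf _ (hNν p hpf)] at h0'
    have h1 := (abs_le.1 (hφB p hpf)).1
    have h2 : -u x - -β / 2 * ‖x‖ ^ 2 ≤ -u p - -β / 2 * ‖p‖ ^ 2 := hmax hx
    have h3 : ⟪p, N p⟫ ≤ R := by
      have := real_inner_le_norm p (N p)
      rw [(hNν p hpf).norm_eq_one, mul_one] at this
      exact this.trans (hR p hp)
    have h4 : β * ⟪p, N p⟫ ≤ β * R := by gcongr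
    have h5 : ‖p‖ ^ 2 ≤ R ^ 2 := by gcongr; exact hR p hp
    have h6 : u p - β * R ^ 2 ≤ u x := by nlinarith [sq_nonneg ‖x‖, sq_nonneg R]
    have h7 : ε * (u p - β * R ^ 2) ≤ ε * u x := by gcongr
    have h8 : ε * (β * R ^ 2) ≤ 1 * (β * R ^ 2) := by gcongr
    rw [supConst, ← hβdef]
    linarith

/-- The maximum principle for `|Du - bN|² + K|x|²/2`: a bound of the gradient through `K`. -/
theorem gradient_sq_le (hk : 2 ≤ k) (hkn : k ≤ n) (hΩ : IsStrictlyConvexDomain 3 Ω)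
    (hN : ContDiff ℝ 2 N) (hNν : ∀ p ∈ frontier Ω, IsOuterUnitNormal Ω p (N p))
    (hsol : IsApproxSolution k Ω α φ ε u) (hε : 0 < ε)
    (hΦ : ContDiffOn ℝ 2 Φ (closure Ω)) (hΦφ : Set.EqOn Φ φ (frontier Ω))
    (hΦ1 : ∀ x ∈ Ω, ‖fderiv ℝ Φ x‖ ≤ B) (hΦ2 : ∀ x ∈ Ω, ‖fderiv ℝ (fderiv ℝ Φ) x‖ ≤ B)
    (ha : 0 < a) (hα : ∀ l, ContDiffOn ℝ 1 (α l) (closure Ω)) (hαa : ∀ l, ∀ x ∈ Ω, a ≤ α l x)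
    (hαA : ∀ l, ∀ x ∈ Ω, α l x ≤ A) (hαD : ∀ l, ∀ x ∈ Ω, ‖fderiv ℝ (α l) x‖ ≤ A)
    (hR : ∀ x ∈ closure Ω, ‖x‖ ≤ R) {κ b₀ c M K : ℝ} (hκ : 0 < κ)
    (hκN : ∀ p ∈ frontier Ω, ∀ τ : E n, ⟪N p, τ⟫ = 0 → κ * ‖τ‖ ^ 2 ≤ ⟪fderiv ℝ N p τ, τ⟫)
    (hb₀ : ∀ x ∈ closure Ω, |Φ x - ε * u x| ≤ b₀)
    (hc0 : ∀ x ∈ closure Ω, ‖N x‖ ≤ c) (hc1 : ∀ x ∈ closure Ω, ‖fderiv ℝ N x‖ ≤ c)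
    (hc2 : ∀ x ∈ closure Ω, ‖fderiv ℝ (fderiv ℝ N) x‖ ≤ c)
    (hM : ∀ x ∈ Ω, ‖fderiv ℝ u x‖ ≤ M) (hK0 : 0 ≤ K)
    (hK : 2 * (M + b₀ * c) * (linConst k a A + (B + ε * linConst k a A) * c
      + 2 * (B + ε * M) * c + b₀ * c) < K) :
    ∀ x ∈ Ω, ‖fderiv ℝ u x‖ ^ 2 ≤
      2 * ((B + 2 * b₀ * c) ^ 2 / κ ^ 2 + K * R / κ + K * R ^ 2 / 2) + 2 * (b₀ * c) ^ 2 := by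
  intro x hx
  have huniq := hΩ.uniqueDiffOn
  have hu2 := hsol.contDiffOn_closure
  set D := fderivWithin ℝ u (closure Ω) with hD
  have hDc : ContinuousOn D (closure Ω) :=
    (hu2.fderivWithin huniq (m := 1) (by norm_num)).continuousOn
  have hDeq : ∀ y ∈ Ω, D y = fderiv ℝ u y := fun y hy =>
    fderivWithin_of_mem_nhds (closure_mem_nhds_of_mem hΩ.isOpen hy)
  have hcont : ContinuousOn
      (fun y => ‖riesz n (D y) - (Φ y - ε * u y) • N y‖ ^ 2 + K / 2 * ‖y‖ ^ 2) (closure Ω) := by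
    have h1 : ContinuousOn (fun y => riesz n (D y)) (closure Ω) :=
      (riesz n).continuous.comp_continuousOn hDc
    have h2 : ContinuousOn (fun y => (Φ y - ε * u y) • N y) (closure Ω) :=
      (hΦ.continuousOn.sub (continuousOn_const.mul hu2.continuousOn)).smul hN.continuous.continuousOn
    exact ((h1.sub h2).norm.pow 2).add (by fun_prop)
  obtain ⟨p, hp, hmax⟩ := hΩ.isCompact_closure.exists_isMaxOn ⟨x, subset_closure hx⟩ hcont
  rcases mem_or_mem_frontier hΩ.isOpen hp with hpΩ | hpf
  · exfalso
    have hpn := closure_mem_nhds_of_mem hΩ.isOpen hpΩ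
    have hu3 : ContDiffAt ℝ 3 u p := hsol.contDiffOn.contDiffAt (hΩ.isOpen.mem_nhds hpΩ)
    obtain ⟨e, w, hw0, hw1, hw2, hw3⟩ := exists_linearized hk hkn hΩ.isOpen ha hpΩ
      hsol.contDiffOn hsol.admissible hsol.equation (fun l => hαa l p hpΩ)
      (fun l => hαA l p hpΩ)
      (fun l => ((hα l).contDiffAt hpn).differentiableAt (by norm_num)) (fun l => hαD l p hpΩ)
    have hloc : IsLocalMax (fun y => ‖riesz n (fderiv ℝ u y) - (Φ y - ε * u y) • N y‖ ^ 2
        + K / 2 * ‖y‖ ^ 2) p := by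
      refine Filter.EventuallyEq.isLocalMax_iff ?_ |>.1 (hmax.isLocalMax hpn)
      filter_upwards [hΩ.isOpen.mem_nhds hpΩ] with y hy
      rw [hDeq y hy]
    have := le_of_isLocalMax hu3 (hΦ.contDiffAt hpn) hN.contDiffAt hε.le hloc hw0 hw1 hw2 hw3
      (hΦ1 p hpΩ) (hΦ2 p hpΩ) (hM p hpΩ) (hb₀ p hp) (hc0 p hp) (hc1 p hp) (hc2 p hp)
    linarith
  · have hbc : ∀ q ∈ frontier Ω, D q (N q) = Φ q - ε * u q := by
      intro q hq
      rw [hsol.neumann q hq _ (hNν q hq), hΦφ hq]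
      ring
    have hΦB : ‖fderivWithin ℝ Φ (closure Ω) p‖ ≤ B := by
      have hΦc : ContinuousOn (fderivWithin ℝ Φ (closure Ω)) (closure Ω) :=
        (hΦ.fderivWithin huniq (m := 1) (by norm_num)).continuousOn
      refine le_on_closure (f := fun y => ‖fderivWithin ℝ Φ (closure Ω) y‖) (g := fun _ => B)
        (fun y hy => ?_) hΦc.norm continuousOn_const hp
      rw [fderivWithin_of_mem_nhds (closure_mem_nhds_of_mem hΩ.isOpen hy)]
      exact hΦ1 y hy
    have hest := boundary_estimate hΩ hN hNν hu2 hΦ hε.le hK0 hbc hpf hmax (hκN p hpf) hΦB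
      (hb₀ p hp) (hc1 p hp) (hR p hp) rfl
    set τ := riesz n (D p) - (Φ p - ε * u p) • N p
    set G := B + 2 * b₀ * c
    -- Young's inequality spends half of the curvature term on the term linear in ‖τ‖.
    have h1 : κ * ‖τ‖ ^ 2 ≤ G ^ 2 / κ + K * R := by
      have h2 : 2 * G * ‖τ‖ ≤ κ * ‖τ‖ ^ 2 + G ^ 2 / κ := by
        have h3 : 0 ≤ (κ * ‖τ‖ - G) ^ 2 / κ := by positivity
        have h4 : (κ * ‖τ‖ - G) ^ 2 / κ = κ * ‖τ‖ ^ 2 - 2 * G * ‖τ‖ + G ^ 2 / κ := by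
          field_simp
          ring
        linarith
      linarith
    have hτ : ‖τ‖ ^ 2 ≤ G ^ 2 / κ ^ 2 + K * R / κ := by
      have h2 : ‖τ‖ ^ 2 ≤ (G ^ 2 / κ + K * R) / κ := by
        rw [le_div_iff₀ hκ]; linarith
      refine h2.trans_eq ?_
      field_simp
    have hxc := subset_closure hx
    have hmx : ‖riesz n (D x) - (Φ x - ε * u x) • N x‖ ^ 2 + K / 2 * ‖x‖ ^ 2
        ≤ ‖τ‖ ^ 2 + K / 2 * ‖p‖ ^ 2 := hmax hxc
    have hpR : K / 2 * ‖p‖ ^ 2 ≤ K / 2 * R ^ 2 := by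
      gcongr; exact hR p hp
    have hx0 : 0 ≤ K / 2 * ‖x‖ ^ 2 := by positivity
    set V := riesz n (D x) - (Φ x - ε * u x) • N x with hV
    have hbN : ‖(Φ x - ε * u x) • N x‖ ≤ b₀ * c := by
      rw [norm_smul, Real.norm_eq_abs]
      exact mul_le_mul (hb₀ x hxc) (hc0 x hxc) (norm_nonneg _)
        ((abs_nonneg _).trans (hb₀ x hxc))
    have hDV : ‖fderiv ℝ u x‖ ≤ ‖V‖ + b₀ * c := by
      rw [← hDeq x hx, ← norm_riesz, show riesz n (D x) = V + (Φ x - ε * u x) • N x by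
        rw [hV]; abel]
      exact (norm_add_le _ _).trans (by gcongr)
    have hsq : ‖fderiv ℝ u x‖ ^ 2 ≤ (‖V‖ + b₀ * c) ^ 2 := by gcongr
    nlinarith [sq_nonneg (‖V‖ - b₀ * c)]

theorem le_of_sq_le {M Q₀ Q₁ : ℝ} (hQ₀ : 0 ≤ Q₀) (hQ₁ : 0 ≤ Q₁)
    (h : M ^ 2 ≤ M ^ 2 / 2 + Q₁ * M + Q₀) : M ≤ 2 * Q₁ + 2 * Q₀ + 1 := by
  by_contra! hlt
  have hM : 1 < M := by linarith
  nlinarith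

theorem abs_sub_average_le (hΩ : IsStrictlyConvexDomain 3 Ω) (hu : ContDiffOn ℝ 2 u (closure Ω))
    {M : ℝ} (hM : ∀ x ∈ Ω, ‖fderiv ℝ u x‖ ≤ M) (hR : ∀ x ∈ closure Ω, ‖x‖ ≤ R) :
    ∀ x ∈ Ω, |u x - (1 / volume.real Ω) * ∫ y in Ω, u y| ≤ M * (2 * R) := by
  intro x hx
  have hM0 : 0 ≤ M := (norm_nonneg _).trans (hM x hx)
  have hfin : volume Ω ≠ ⊤ := hΩ.isBounded.measure_lt_top.ne
  have hpos : 0 < volume.real Ω :=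
    ENNReal.toReal_pos (hΩ.isOpen.measure_pos volume hΩ.nonempty).ne' hfin
  have hosc : ∀ y ∈ Ω, ‖u x - u y‖ ≤ M * (2 * R) := by
    intro y hy
    have h1 := hΩ.convex.norm_image_sub_le_of_norm_fderiv_le (𝕜 := ℝ) (f := u)
      (fun z hz => (hu.contDiffAt (closure_mem_nhds_of_mem hΩ.isOpen hz)).differentiableAt
        (by norm_num)) hM hy hx
    refine h1.trans ?_
    have h2 := norm_sub_le x y
    have h3 := hR x (subset_closure hx)
    have h4 := hR y (subset_closure hy)
    gcongr
    linarith
  have hint : IntegrableOn u Ω :=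
    (hu.continuousOn.integrableOn_compact hΩ.isCompact_closure).mono_set subset_closure
  have hconst : IntegrableOn (fun _ => u x) Ω := integrableOn_const hfin
  have h1 : ∫ y in Ω, (u x - u y) = volume.real Ω * u x - ∫ y in Ω, u y := by
    rw [integral_sub hconst hint, setIntegral_const, smul_eq_mul]
  have h2 := norm_setIntegral_le_of_norm_le_const (μ := volume) hΩ.isBounded.measure_lt_top hosc
  rw [h1, Real.norm_eq_abs] at h2
  have h3 : u x - (1 / volume.real Ω) * ∫ y in Ω, u y
      = (volume.real Ω * u x - ∫ y in Ω, u y) / volume.real Ω := by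
    field_simp
  rw [h3, abs_div, abs_of_pos hpos, div_le_iff₀ hpos]
  exact h2

end Estimates

/-- The numerical step which absorbs the quadratic term for small `ε`. -/
theorem le_of_maximum_principle {M ε C B c s L P₀ P₁ : ℝ} (hM : 0 ≤ M) (hε1 : ε ≤ 1)
    (hC : 0 ≤ C) (hc : 0 ≤ c) (hB : 0 ≤ B) (hs : 0 ≤ s) (hP₀ : 0 ≤ P₀) (hP₁ : 0 ≤ P₁)
    (hL : L = C + (B + C) * c + 2 * B * c + s) (hεP : ε * (8 * c * P₁) ≤ 1)
    (h : M ^ 2 ≤ P₀ + P₁ *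
      (2 * (M + s) * (C + (B + ε * C) * c + 2 * (B + ε * M) * c + s) + 1)) :
    M ≤ 2 * (P₁ * (2 * L + 4 * s * c)) + 2 * (P₀ + P₁ * (2 * s * L + 1)) + 1 := by
  have hL0 : 0 ≤ L := by rw [hL]; positivity
  refine le_of_sq_le (by positivity) (by positivity) (h.trans ?_)
  have h1 : C + (B + ε * C) * c + 2 * (B + ε * M) * c + s ≤ L + 2 * c * (ε * M) := by
    have : ε * C * c ≤ 1 * C * c := by gcongr
    rw [hL]
    linarith
  have h2 : P₁ * (2 * (M + s) * (C + (B + ε * C) * c + 2 * (B + ε * M) * c + s) + 1)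
      ≤ P₁ * (2 * (M + s) * (L + 2 * c * (ε * M)) + 1) := by gcongr
  -- The quadratic term is 4cP₁εM², at most M²/2 by the smallness of ε.
  have h3 : M ^ 2 * (ε * (8 * c * P₁)) ≤ M ^ 2 * 1 := by gcongr
  have h4 : ε * (P₁ * s * c * M) ≤ 1 * (P₁ * s * c * M) := by gcongr
  linarith

end MixedHessian

end

/-! ### Choice of the constants and conclusion -/

theorem theorem3p2 (n k : ℕ) (hk : 2 ≤ k) (hkn : k ≤ n)
    (Ω : Set (MixedHessian.E n)) (hΩ : MixedHessian.IsStrictlyConvexDomain 3 Ω)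
    (a : ℝ) (ha : 0 < a) (A B : ℝ≥0) :
    ∃ ε₀ M₁ M₀ : ℝ, 0 < ε₀ ∧
      ∀ (α : Fin k → MixedHessian.E n → ℝ) (φ : MixedHessian.E n → ℝ),
        (∀ l, ContDiffOn ℝ 1 (α l) (closure Ω)) →
        (∀ l, ∀ x ∈ closure Ω, a ≤ α l x) →
        (∀ l, MixedHessian.cNorm 1 Ω (α l) ≤ A) →
        MixedHessian.MemCBoundary 2 Ω φ →
        MixedHessian.cBoundaryNorm 2 Ω φ ≤ B →
        ∀ (ε : ℝ), 0 < ε → ε < ε₀ →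
        ∀ u : MixedHessian.E n → ℝ, MixedHessian.IsApproxSolution k Ω α φ ε u →
          (∀ x ∈ Ω, ‖gradient u x‖ ≤ M₁) ∧
          (∀ x ∈ Ω, |u x - (1 / volume.real Ω) * ∫ y in Ω, u y| ≤ M₀) := by
  obtain ⟨N, hN, hNν⟩ := MixedHessian.exists_normal_field hΩ
  obtain ⟨κ, hκ, hκN⟩ := MixedHessian.exists_curvature_bound hΩ hN hNν
  have hcomp := hΩ.isCompact_closure
  have hN1 : ContDiff ℝ 1 (fderiv ℝ N) := hN.fderiv_right (by norm_num)
  obtain ⟨R, hR⟩ := hcomp.exists_bound_of_continuousOn (f := fun x => x) continuousOn_id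
  obtain ⟨c₀, hc₀⟩ := hcomp.exists_bound_of_continuousOn hN.continuous.continuousOn
  obtain ⟨c₁, hc₁⟩ := hcomp.exists_bound_of_continuousOn hN1.continuous.continuousOn
  obtain ⟨c₂, hc₂⟩ := hcomp.exists_bound_of_continuousOn
    (hN1.continuous_fderiv (by norm_num)).continuousOn
  obtain ⟨x₀, hx₀⟩ := hΩ.nonempty
  have hR0 : 0 ≤ R := (norm_nonneg _).trans (hR x₀ (subset_closure hx₀))
  set c : ℝ := max c₀ (max c₁ c₂)
  have hc0 : ∀ x ∈ closure Ω, ‖N x‖ ≤ c := fun x hx => (hc₀ x hx).trans (le_max_left _ _)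
  have hc1 : ∀ x ∈ closure Ω, ‖fderiv ℝ N x‖ ≤ c := fun x hx =>
    (hc₁ x hx).trans ((le_max_left _ _).trans (le_max_right _ _))
  have hc2 : ∀ x ∈ closure Ω, ‖fderiv ℝ (fderiv ℝ N) x‖ ≤ c := fun x hx =>
    (hc₂ x hx).trans ((le_max_right _ _).trans (le_max_right _ _))
  have hc : 0 ≤ c := (norm_nonneg _).trans (hc0 x₀ (subset_closure hx₀))
  set B' : ℝ := ((B + 1 : ℝ≥0) : ℝ) with hB'
  have hB'0 : 0 ≤ B' := NNReal.coe_nonneg _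
  have hA0 : (0 : ℝ) ≤ A := A.2
  set b₁ : ℝ := MixedHessian.supConst k A B' R with hb₁
  have hB'b₁ : B' ≤ b₁ := by
    have : 0 ≤ ((k : ℝ) * (1 + k * A) + 1) * (R + R ^ 2) := by positivity
    rw [hb₁, MixedHessian.supConst]
    linarith
  set b₀ : ℝ := B' + b₁ with hb₀def
  have hb₀ : 0 ≤ b₀ := by linarith
  set C : ℝ := MixedHessian.linConst k a A with hCdef
  have hC : 0 ≤ C := by
    rw [hCdef, MixedHessian.linConst]
    positivity
  set P₀ : ℝ := 2 * ((B' + 2 * b₀ * c) ^ 2 / κ ^ 2) + 2 * (b₀ * c) ^ 2 with hP₀def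
  set P₁ : ℝ := 2 * (R / κ) + R ^ 2 with hP₁def
  have hP₀ : 0 ≤ P₀ := by positivity
  have hP₁ : 0 ≤ P₁ := by positivity
  set L : ℝ := C + (B' + C) * c + 2 * B' * c + b₀ * c with hL
  set M₁ : ℝ := 2 * (P₁ * (2 * L + 4 * (b₀ * c) * c)) +
    2 * (P₀ + P₁ * (2 * (b₀ * c) * L + 1)) + 1 with hM₁
  -- The added 1 keeps the denominator positive and also yields ε ≤ 1.
  refine ⟨1 / (8 * c * P₁ + 1), M₁, M₁ * (2 * R), by positivity, ?_⟩
  intro α φ hα hαa hαA _ hφB ε hε hε₀ u hsol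
  obtain ⟨Φ, ⟨hΦ, hΦφ⟩, hΦB⟩ := MixedHessian.exists_extension_of_cBoundaryNorm_le hφB
  have hden : 0 < 8 * c * P₁ + 1 := by positivity
  have hεP' : ε * (8 * c * P₁ + 1) < 1 := (lt_div_iff₀ hden).1 hε₀
  have hεP : ε * (8 * c * P₁) ≤ 1 := by linarith
  have hε1 : ε ≤ 1 := by
    have : 0 ≤ ε * (8 * c * P₁) := by positivity
    linarith
  have hΦ0 : ∀ x ∈ closure Ω, |Φ x| ≤ B' := fun x hx =>
    le_on_closure (f := fun y => |Φ y|) (g := fun _ => B')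
      (fun y hy => MixedHessian.abs_le_of_cNorm hΦB hy) hΦ.continuousOn.abs continuousOn_const hx
  have hφ0 : ∀ p ∈ frontier Ω, |φ p| ≤ B' := fun p hp => hΦφ hp ▸ hΦ0 p hp.1
  have hαA' : ∀ l, ∀ x ∈ Ω, α l x ≤ A := fun l x hx =>
    (le_abs_self _).trans (MixedHessian.abs_le_of_cNorm (hαA l) hx)
  have hαa' : ∀ l, ∀ x ∈ Ω, a ≤ α l x := fun l x hx => hαa l x (subset_closure hx)
  have hb : ∀ x ∈ closure Ω, |Φ x - ε * u x| ≤ b₀ := by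
    intro x hx
    have h1 := MixedHessian.eps_mul_le hk hkn hΩ hNν hsol hε hφ0 hx
    have h2 := MixedHessian.neg_le_eps_mul hk hkn hΩ hNν hsol hε hε1 hφ0 hR
      (fun l x hx => ha.le.trans (hαa' l x hx)) hαA' hA0 hx
    have h3 : |ε * u x| ≤ b₁ := abs_le.2 ⟨h2, h1.trans hB'b₁⟩
    exact (abs_sub _ _).trans (add_le_add (hΦ0 x hx) h3)
  have hDc : ContinuousOn (fun y => ‖fderivWithin ℝ u (closure Ω) y‖) (closure Ω) :=
    (hsol.contDiffOn_closure.fderivWithin hΩ.uniqueDiffOn (m := 1) (by norm_num)).continuousOn.norm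
  have hDeq : ∀ y ∈ Ω, fderivWithin ℝ u (closure Ω) y = fderiv ℝ u y := fun y hy =>
    fderivWithin_of_mem_nhds (MixedHessian.closure_mem_nhds_of_mem hΩ.isOpen hy)
  obtain ⟨z, hz, hzmax⟩ := hcomp.exists_isMaxOn ⟨x₀, subset_closure hx₀⟩ hDc
  -- M depends on u, but is finite because u is C² up to the boundary.
  set M : ℝ := ‖fderivWithin ℝ u (closure Ω) z‖
  have hM : ∀ x ∈ Ω, ‖fderiv ℝ u x‖ ≤ M := fun x hx => hDeq x hx ▸ hzmax (subset_closure hx)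
  have hM0 : 0 ≤ M := norm_nonneg _
  -- One more than the interior bound for K, so the maximum of G lies on ∂Ω.
  set K : ℝ := 2 * (M + b₀ * c) *
    (C + (B' + ε * C) * c + 2 * (B' + ε * M) * c + b₀ * c) + 1 with hKdef
  have hK0 : 0 ≤ K := by positivity
  have hgrad := MixedHessian.gradient_sq_le hk hkn hΩ hN hNν hsol hε hΦ hΦφ
    (fun x hx => MixedHessian.norm_fderiv_le_of_cNorm hΦB (by norm_num) hx)
    (fun x hx => MixedHessian.norm_snd_fderiv_le_of_cNorm hΦB (by norm_num) hx) ha hα hαa' hαA'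
    (fun l x hx => MixedHessian.norm_fderiv_le_of_cNorm (hαA l) le_rfl hx) hR hκ hκN hb
    hc0 hc1 hc2 hM hK0 (lt_add_one _)
  have hMK : M ^ 2 ≤ P₀ + P₁ * K := by
    have := le_on_closure (f := fun y => ‖fderivWithin ℝ u (closure Ω) y‖ ^ 2)
      (fun y hy => by rw [hDeq y hy]; exact hgrad y hy) (hDc.pow 2) continuousOn_const hz
    refine this.trans_eq ?_
    rw [hP₀def, hP₁def]
    ring
  have hMM₁ : M ≤ M₁ := MixedHessian.le_of_maximum_principle hM0 hε1 hC hc hB'0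
    (by positivity) hP₀ hP₁ hL hεP hMK
  have hfin : ∀ x ∈ Ω, ‖fderiv ℝ u x‖ ≤ M₁ := fun x hx => (hM x hx).trans hMM₁
  refine ⟨fun x hx => ?_, MixedHessian.abs_sub_average_le hΩ hsol.contDiffOn_closure hfin hR⟩
  rw [MixedHessian.gradient_eq_riesz, MixedHessian.norm_riesz]
  exact hfin x hx
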